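/- \textbf{Conventions.} Directed graphs have a finite vertex set $V$ and no self-loops; directed cycles, including two-cycles $j\rightleftarrows k$, are allowed, and a graph without directed cycles is a DAG. An ancestor of $v$ is a vertex from which a directed path (with at least one edge) leads to $v$, and $\mathrm{an}(S)$ consists of $S$ and all ancestors of its elements. For $j\ne k$ and $S\subseteq V\setminus\{j,k\}$, $j$ and $k$ are d-connected given $S$ in $G$ if some undirected path between them (distinct vertices) has every collider in $\mathrm{an}(S)$ and no interior non-collider in $S$; otherwise they are d-separated given $S$. $D_{sep}(G)$ is the set of all d-separation rules ``$j$ is d-separated from $k$ given $S$'' of $G$ (with $\{j,k\}$ unordered). The skeleton $S(G)$ is the set of pairs $\{j,k\}$, $j\neq k$, that are really adjacent ($j\to k$ or $k\to j$) or virtually adjacent ($j$ and $k$ have a common child that is an ancestor of $j$ or of $k$). For a probability distribution $\mathbb P$ of a real random vector $(X_v)_{v\in V}$, $(G,\mathbb P)$ satisfies the causal Markov condition (CMC) if $X_j\perp X_k\mid X_S$ under $\mathbb P$ whenever $j$ and $k$ are d-separated given $S$ in $G$. Two graphs are Markov equivalent if exactly the same distributions satisfy the CMC for both; $\mathcal M(G)$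 is the Markov equivalence class of $G$. Let $\mathcal C$ be a class of directed graphs on $V$. Suppose that $(G^*,\mathbb P)$ satisfies the CMC and consider all $G\in\mathcal C\setminus\mathcal M(G^*)$ such that $(G,\mathbb P)$ satisfies the CMC. Relative to $\mathcal C$, $(G^*,\mathbb P)$ satisfies the \emph{identifiable SMR} assumption if $|S(G^*)|<|S(G)|$ for all these $G$, the \emph{weak SMR} assumption if $|S(G^*)|\le|S(G)|$ for all these $G$, and the \emph{MDR} assumption if $|D_{sep}(G)|<|D_{sep}(G^*)|$ for all these $G$. $(G,\mathbb P)$ is a \emph{linear Gaussian} model if $\mathbb P$ is the law of the solution of $X=BX+\varepsilon$, where $I-B$ is invertible, $B_{kj}\ne0$ exactly if $j\to k$ in $G$, and the $\varepsilon_k$ are independent centred Gaussians of positive variance. \textbf{Lemma.} The MDR and SMR assumptions are incomparable: (a) There are a distribution $\mathbb P$ on $\mathbb R^5$ and DAGs $G_1,G_2$ on $5$ vertices such that, both relative to the class of all DAGs and relative to the class of all directed graphs on these vertices, $(G_2,\mathbb P)$ satisfies the identifiable SMR assumption but not the MDR assumption, and $(G_1,\mathbb P)$ satisfies the MDR assumption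 but not the weak SMR assumption. (b) There are a distribution $\mathbb P$ on $\mathbb R^{12}$ and directed graphs $G_1,G_2$ on $12$ vertices, neither of which is a DAG, such that $(G_2,\mathbb P)$ is a linear Gaussian model and, relative to the class of all directed graphs on these vertices, $(G_2,\mathbb P)$ satisfies the identifiable SMR assumption but not the MDR assumption, and $(G_1,\mathbb P)$ satisfies the MDR assumption but not the weak SMR assumption. -/

import Mathlib

open MeasureTheory ProbabilityTheory
open scoped NNReal

noncomputable section

/-- A directed graph without self-loops on the vertex set `V`. Directed cycles are allowed,
including two-cycles `j → k → j`. `G.Adj j k` means `j → k`. -/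
structure DirGraph (V : Type*) extends Digraph V where
  loopless : ∀ v, ¬ Adj v v

namespace DirGraph

variable {V : Type*}

/-- `j` is an ancestor of `k`: there is a directed path `j → ⋯ → k` with at least one edge. -/
def IsAncestor (G : DirGraph V) (j k : V) : Prop :=
  Relation.TransGen G.Adj j k

/-- `G` is a DAG: it has no directed cycle. -/
def IsAcyclic (G : DirGraph V) : Prop :=
  ∀ v, ¬ G.IsAncestor v v

/-- `an(S)`: the vertices that lie in `S` or are ancestors of a vertex of `S`. -/
def an (G : DirGraph V) (S : Finset V) : Set V :=
  {v | v ∈ S ∨ ∃ s ∈ S, G.IsAncestor v s}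

/-- An undirected path from `j` to `k`: distinct vertices `vert 0 = j, …, vert len = k`, and for
each `i < len` an edge of `G` joining `vert i` and `vert (i + 1)`, which points forward
(`vert i → vert (i + 1)`) if `fwd i = true` and backward if `fwd i = false`. The direction is
recorded since a two-cycle offers both. Values beyond `len` are irrelevant. -/
structure UPath (G : DirGraph V) (j k : V) where
  len : ℕ
  vert : ℕ → V
  fwd : ℕ → Bool
  vert_zero : vert 0 = j
  vert_len : vert len = k
  injOn : Set.InjOn vert (Set.Iic len)
  edge_fwd : ∀ i < len, fwd i = true → G.Adj (vert i) (vert (i + 1))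
  edge_bwd : ∀ i < len, fwd i = false → G.Adj (vert (i + 1)) (vert i)

/-- The interior vertex `vert (i + 1)` is a collider on the path: both path edges at it point
into it. -/
def UPath.IsCollider {G : DirGraph V} {j k : V} (π : G.UPath j k) (i : ℕ) : Prop :=
  π.fwd i = true ∧ π.fwd (i + 1) = false

/-- `j` and `k` are d-connected given `S`: some undirected path between them has all its colliders
in `an(S)` and none of its interior non-colliders in `S`. -/
def DConnected (G : DirGraph V) (j k : V) (S : Finset V) : Prop :=
  ∃ π : G.UPath j k, ∀ i, i + 1 < π.len →
    (π.IsCollider i → π.vert (i + 1) ∈ G.an S) ∧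
    (¬ π.IsCollider i → π.vert (i + 1) ∉ S)

/-- `j` and `k` are d-separated given `S`. -/
def DSeparated (G : DirGraph V) (j k : V) (S : Finset V) : Prop :=
  ¬ G.DConnected j k S

/-- `D_sep(G)`: the d-separation rules "`j` is d-separated from `k` given `S`" entailed by `G`,
with `j ≠ k` and `S ⊆ V \ {j, k}`; the pair `j, k` is unordered. -/
def dsep (G : DirGraph V) : Set (Sym2 V × Finset V) :=
  {r | ∃ j k : V, r.1 = s(j, k) ∧ j ≠ k ∧ j ∉ r.2 ∧ k ∉ r.2 ∧ G.DSeparated j k r.2}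

/-- `j → k` or `k → j`. -/
def ReallyAdjacent (G : DirGraph V) (j k : V) : Prop :=
  G.Adj j k ∨ G.Adj k j

/-- `j` and `k` have a common child that is an ancestor of `j` or of `k`. -/
def VirtuallyAdjacent (G : DirGraph V) (j k : V) : Prop :=
  ∃ l, G.Adj j l ∧ G.Adj k l ∧ (G.IsAncestor l j ∨ G.IsAncestor l k)

/-- The skeleton `S(G)`: the undirected graph of the real and virtual edges of `G`. -/
def skeleton (G : DirGraph V) : SimpleGraph V where
  Adj j k := j ≠ k ∧ (G.ReallyAdjacent j k ∨ G.VirtuallyAdjacent j k)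
  symm := ⟨by
    rintro j k ⟨hne, h | ⟨l, h1, h2, h3⟩⟩
    · exact ⟨hne.symm, Or.inl h.symm⟩
    · exact ⟨hne.symm, Or.inr ⟨l, h2, h1, h3.symm⟩⟩⟩
  loopless := ⟨fun _ h => h.1 rfl⟩

/-- `|S(G)|`: the number of real or virtual edges. -/
def numEdges (G : DirGraph V) : ℕ :=
  G.skeleton.edgeSet.ncard

/-- `|D_sep(G)|`: the number of d-separation rules entailed by `G`. -/
def numRules (G : DirGraph V) : ℕ :=
  G.dsep.ncard

end DirGraph

section Models

variable {V : Type*} [Fintype V]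

/-- `X_j ⫫ X_k ∣ X_S` for the coordinate vector `X` of law `P` on `V → ℝ`: conditional
independence of the coordinates `j` and `k` given the σ-algebra generated by those in `S`. -/
def CIStatement (P : ProbabilityMeasure (V → ℝ)) (j k : V) (S : Finset V) : Prop :=
  CondIndepFun (MeasurableSpace.comap S.restrict MeasurableSpace.pi)
    (S.measurable_restrict).comap_le
    (fun x : V → ℝ => x j) (fun x : V → ℝ => x k) (P : Measure (V → ℝ))

/-- The causal Markov condition: every d-separation rule of `G` holds as a conditional independence
statement of `P`. -/
def CMC (G : DirGraph V) (P : ProbabilityMeasure (V → ℝ)) : Prop :=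
  ∀ (j k : V) (S : Finset V), j ≠ k → j ∉ S → k ∉ S → G.DSeparated j k S → CIStatement P j k S

/-- Two graphs are Markov equivalent if the same distributions satisfy the CMC for both. -/
def MarkovEquiv (G₁ G₂ : DirGraph V) : Prop :=
  ∀ P : ProbabilityMeasure (V → ℝ), CMC G₁ P ↔ CMC G₂ P

/-- `(G, P)` satisfies the identifiable SMR assumption, `G` being compared with the graphs in the
class `C` (all DAGs, or all directed graphs). -/
def IdentifiableSMR (C : Set (DirGraph V)) (G : DirGraph V) (P : ProbabilityMeasure (V → ℝ)) :
    Prop :=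
  CMC G P ∧ ∀ H ∈ C, CMC H P → ¬ MarkovEquiv H G → G.numEdges < H.numEdges

/-- `(G, P)` satisfies the weak SMR (frugality) assumption within the class `C`. -/
def WeakSMR (C : Set (DirGraph V)) (G : DirGraph V) (P : ProbabilityMeasure (V → ℝ)) : Prop :=
  CMC G P ∧ ∀ H ∈ C, CMC H P → ¬ MarkovEquiv H G → G.numEdges ≤ H.numEdges

/-- `(G, P)` satisfies the maximum d-separation rules (MDR) assumption within the class `C`. -/
def MDR (C : Set (DirGraph V)) (G : DirGraph V) (P : ProbabilityMeasure (V → ℝ)) : Prop :=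
  CMC G P ∧ ∀ H ∈ C, CMC H P → ¬ MarkovEquiv H G → H.numRules < G.numRules

/-- `(G, P)` is a linear Gaussian model: `P` is the law of the solution `X` of `X = B X + ε`, where
the weight `B k j` of `j → k` is nonzero exactly if `j → k` is an edge, `1 - B` is invertible, and
the errors `ε k` are independent centred Gaussians of positive variance. -/
def IsLinearGaussian [DecidableEq V] (G : DirGraph V) (P : ProbabilityMeasure (V → ℝ)) : Prop :=
  ∃ (B : Matrix V V ℝ) (σ2 : V → ℝ≥0),
    (∀ j k, B k j ≠ 0 ↔ G.Adj j k) ∧ IsUnit (1 - B).det ∧ (∀ k, σ2 k ≠ 0) ∧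
    (P : Measure (V → ℝ)) =
      (Measure.pi fun k => gaussianReal 0 (σ2 k)).map (fun ε => (1 - B)⁻¹.mulVec ε)

end Models

end

/-!
The number of edges of a directed graph is the number of pairs of vertices about which it entails no
d-separation rule. So the sparsest graph is the one with rules about the most *pairs*, whereas MDR
counts the *rules*, and a graph can gather many rules on few pairs.

On five vertices take the family `rules₁` of the four rules `0 ⫫ 3`, `0 ⫫ 3 ∣ 4`, `3 ⫫ 4`,
`3 ⫫ 4 ∣ 0`, which concern two pairs, and the family `rules₂` of the three rules `0 ⫫ 3`,
`0 ⫫ 4 ∣ 1, 2, 3`, `1 ⫫ 2 ∣ 0, 3`, which concern three pairs. They are exactly the rules of the two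
graphs `graph₁` and `graph₂`. By `dsep_eq_or_of_subset_rules`, every directed graph, cyclic or not,
with rules only in the union of the two families either has exactly the rules `rules₂`, or has rules
about at most two pairs, and in the latter case it has less than four rules unless they are exactly
`rules₁`. If the conditional independence statements of a distribution `P` are exactly the rules of
the union, then the graphs satisfying the causal Markov condition with `P` are those with rules in
the union; hence `graph₂` is the strictly sparsest one and `graph₁` strictly the one with the most
rules, up to Markov equivalence. This is `incomparable_of_rules`. That the two graphs are not Markov
equivalent is seen from a Gaussian law in which only `X₃` and `X₄` are correlated.

Such a `P` is Gaussian. For a Gaussian vector with covariances `⟪x i, x j⟫`, the statement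
`X_j ⫫ X_k ∣ X_S` says that `x j` and `x k` are orthogonal after projecting out `x s`, `s ∈ S`
(`ciStatement_iff_partiallyOrthogonal`): the residual of `X_j` on `X_S` is independent of `X_S`, and
independent of `(X_S, X_k)` if and only if it is uncorrelated with `X_k`. On five vertices the
linear model `coreVec` has exactly the rules in the union; its only cancellation is the total effect
of `X₃` on `X₄`.

On twelve vertices the other seven are added as sinks, children of all previous vertices, with
generic small weights, so that no further conditional independence arises and none is lost
(`exists_generic_sinks`). Adding the edge from `11` to `10` creates a two-cycle, so that neither
graph is a DAG, but no new rules. The same law is that of a linear Gaussian model with this edge: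
given a weight for it, the weights of the other edges into `10` and `11` can be chosen such that the
two error terms are only rotated and scaled, so remain independent
(`exists_isLinearGaussian_graph₂_twelve`).
-/

/-! ### Open walks and d-separation in directed graphs -/

namespace DirGraph

section Separation

variable {V : Type*} {G : DirGraph V} {j k : V} {S : Finset V}

/-- Soundness of separation in the moral graph of an ancestral set `A`, in the case where `S` cuts
off the single vertex `j`. All vertices of a d-connecting path lie in `A`; its first vertex after
`j` lies in `S`, hence is a collider, and then the second one is moral-adjacent to `j` too, hence
is a non-collider in `S`. -/
theorem dSeparated_of_ancestral {A : Set V} (hA : ∀ u v, v ∈ A → G.Adj u v → u ∈ A)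
    (hj : j ∈ A) (hk : k ∈ A) (hS : ∀ s ∈ S, s ∈ A) (hjk : j ≠ k) (hkS : k ∉ S)
    (h : ∀ v ∈ A, v ∉ S → v ≠ j →
      ¬ G.Adj j v ∧ ¬ G.Adj v j ∧ ∀ l ∈ A, G.Adj j l → ¬ G.Adj v l) :
    G.DSeparated j k S := by
  rintro ⟨π, hπ⟩
  have hanc : ∀ u v, G.IsAncestor u v → v ∈ A → u ∈ A := by
    intro u v huv
    induction huv using Relation.TransGen.head_induction_on with
    | single h => exact fun hv => hA _ _ hv h
    | head h _ ih => exact fun hv => hA _ _ (ih hv) h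
  have han : ∀ v ∈ G.an S, v ∈ A := by
    rintro v (hv | ⟨s, hs, hv⟩)
    · exact hS v hv
    · exact hanc _ _ hv (hS s hs)
  have hfwd : ∀ d i, i + d + 1 = π.len → π.fwd i = true → π.vert i ∈ A := by
    intro d
    induction d with
    | zero =>
      intro i hi hf
      have := π.edge_fwd i (by omega) hf
      rw [show i + 1 = π.len by omega, π.vert_len] at this
      exact hA _ _ hk this
    | succ d ih =>
      intro i hi hf
      refine hA _ _ ?_ (π.edge_fwd i (by omega) hf)
      cases hf' : π.fwd (i + 1) with
      | true => exact ih (i + 1) (by omega) hf'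
      | false => exact han _ ((hπ i (by omega)).1 ⟨hf, hf'⟩)
  have hbwd : ∀ i, i < π.len → π.fwd i = false → π.vert (i + 1) ∈ A := by
    intro i
    induction i with
    | zero =>
      intro hi hf
      have := π.edge_bwd 0 hi hf
      rw [π.vert_zero] at this
      exact hA _ _ hj this
    | succ i ih =>
      intro hi hf
      refine hA _ _ ?_ (π.edge_bwd (i + 1) hi hf)
      cases hf' : π.fwd i with
      | true => exact han _ ((hπ i (by omega)).1 ⟨hf', hf⟩)
      | false => exact ih (by omega) hf'
  have hmem : ∀ i, i < π.len → π.vert (i + 1) ∈ A := by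
    intro i hi
    rcases Nat.lt_or_ge (i + 1) π.len with h1 | h1
    · cases hf : π.fwd (i + 1) with
      | true => exact hfwd (π.len - (i + 1) - 1) (i + 1) (by omega) hf
      | false =>
        cases hf' : π.fwd i with
        | true => exact han _ ((hπ i h1).1 ⟨hf', hf⟩)
        | false => exact hbwd i hi hf'
    · rw [show i + 1 = π.len by omega, π.vert_len]; exact hk
  have hne : ∀ i, i < π.len → π.vert (i + 1) ≠ j := by
    intro i hi he
    have := π.injOn (Set.mem_Iic.2 (show i + 1 ≤ π.len by omega))
      (Set.mem_Iic.2 (Nat.zero_le _)) (he.trans π.vert_zero.symm)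
    omega
  have h0 : 0 < π.len := by
    rcases Nat.eq_zero_or_pos π.len with h0 | h0
    · exact absurd (π.vert_zero.symm.trans (h0 ▸ π.vert_len)) hjk
    · exact h0
  have hlt : ∀ i, i ≤ π.len → π.vert i ∈ S → i < π.len := by
    intro i hi hs
    refine lt_of_le_of_ne hi fun he => hkS ?_
    rwa [← π.vert_len, ← he]
  have he0 := π.vert_zero
  have h1S : π.vert 1 ∈ S := by
    by_contra hs
    obtain ⟨h1, h2, -⟩ := h _ (hmem 0 h0) hs (hne 0 h0)
    cases hf : π.fwd 0 with
    | true => exact h1 (by simpa [he0] using π.edge_fwd 0 h0 hf)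
    | false => exact h2 (by simpa [he0] using π.edge_bwd 0 h0 hf)
  have hl1 := hlt 1 h0 h1S
  have hcol : π.IsCollider 0 := by
    by_contra hc
    exact (hπ 0 hl1).2 hc h1S
  have h2S : π.vert 2 ∈ S := by
    by_contra hs
    exact (h _ (hmem 1 hl1) hs (hne 1 hl1)).2.2 _ (hmem 0 h0)
      (by simpa [he0] using π.edge_fwd 0 h0 hcol.1) (π.edge_bwd 1 hl1 hcol.2)
  exact (hπ 1 (hlt 2 hl1 h2S)).2 (fun hc => Bool.false_ne_true (hcol.2.symm.trans hc.1)) h2S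

/-- `DSeparated` is symmetric: a path can be read backwards. -/
theorem DConnected.symm (h : G.DConnected j k S) : G.DConnected k j S := by
  obtain ⟨π, hπ⟩ := h
  refine ⟨⟨π.len, fun i => π.vert (π.len - i), fun i => !π.fwd (π.len - 1 - i), ?_, ?_, ?_, ?_, ?_⟩,
    ?_⟩
  · simp [π.vert_len]
  · simp [π.vert_zero]
  · intro a ha b hb hab
    have := π.injOn (Set.mem_Iic.2 (Nat.sub_le _ a)) (Set.mem_Iic.2 (Nat.sub_le _ b)) hab
    simp only [Set.mem_Iic] at ha hb
    omega
  · intro i hi hf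
    have := π.edge_bwd (π.len - 1 - i) (by omega) (by simpa using hf)
    rwa [show π.len - 1 - i + 1 = π.len - i by omega,
      show π.len - 1 - i = π.len - (i + 1) by omega] at this
  · intro i hi hf
    have := π.edge_fwd (π.len - 1 - i) (by omega) (by simpa using hf)
    rwa [show π.len - 1 - i + 1 = π.len - i by omega,
      show π.len - 1 - i = π.len - (i + 1) by omega] at this
  · intro i hi
    dsimp only at hi ⊢
    have := hπ (π.len - (i + 2)) (by omega)
    rw [show π.len - (i + 2) + 1 = π.len - (i + 1) by omega] at this
    simp only [UPath.IsCollider] at this ⊢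
    rw [show π.len - (i + 2) + 1 = π.len - 1 - i by omega,
      show π.len - (i + 2) = π.len - 1 - (i + 1) by omega] at this
    cases h1 : π.fwd (π.len - 1 - (i + 1)) <;> cases h2 : π.fwd (π.len - 1 - i) <;>
      simp_all

theorem dSeparated_comm : G.DSeparated j k S ↔ G.DSeparated k j S :=
  ⟨fun h h' => h h'.symm, fun h h' => h h'.symm⟩

/-- An open walk of length `n` from `j` to `k`: the conditions of a d-connecting path, without the
demand that its vertices be distinct. -/
structure OpenWalk (G : DirGraph V) (S : Finset V) (j k : V) (n : ℕ) where
  vert : ℕ → V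
  fwd : ℕ → Bool
  vert_zero : vert 0 = j
  vert_len : vert n = k
  edge_fwd : ∀ i < n, fwd i = true → G.Adj (vert i) (vert (i + 1))
  edge_bwd : ∀ i < n, fwd i = false → G.Adj (vert (i + 1)) (vert i)
  collider : ∀ i, i + 1 < n → fwd i = true → fwd (i + 1) = false → vert (i + 1) ∈ G.an S
  nonCollider : ∀ i, i + 1 < n → ¬ (fwd i = true ∧ fwd (i + 1) = false) → vert (i + 1) ∉ S

theorem mem_an_of_adj {u v : V} (h : G.Adj u v) (hv : v ∈ G.an S) : u ∈ G.an S := by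
  rcases hv with hv | ⟨s, hs, hv⟩
  · exact Or.inr ⟨v, hv, .single h⟩
  · exact Or.inr ⟨s, hs, hv.head h⟩

/-- A stretch of an open walk that starts forward and ends backward contains a collider, of which
its first vertex is an ancestor. -/
theorem OpenWalk.mem_an {n : ℕ} (w : G.OpenWalk S j k n) (d i : ℕ) (hlt : i + d + 1 < n)
    (hi : w.fwd i = true) (hm : w.fwd (i + d + 1) = false) : w.vert i ∈ G.an S := by
  induction d generalizing i with
  | zero => exact mem_an_of_adj (w.edge_fwd i (by omega) hi) (w.collider i (by omega) hi hm)
  | succ d ih =>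
    refine mem_an_of_adj (w.edge_fwd i (by omega) hi) ?_
    cases hf : w.fwd (i + 1) with
    | true =>
      exact ih (i + 1) (by omega) hf (by rwa [show i + 1 + d + 1 = i + (d + 1) + 1 by omega])
    | false => exact w.collider i (by omega) hi hf

/-- A loop `vert a = vert b` can be cut out of an open walk. -/
theorem OpenWalk.exists_shorter {n a b : ℕ} (w : G.OpenWalk S j k n) (hab : a < b) (hb : b ≤ n)
    (he : w.vert a = w.vert b) : Nonempty (G.OpenWalk S j k (n - (b - a))) := by
  refine ⟨⟨fun i => if i ≤ a then w.vert i else w.vert (i + (b - a)),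
    fun i => if i < a then w.fwd i else w.fwd (i + (b - a)), ?_, ?_, ?_, ?_, ?_, ?_⟩⟩
  · simp [w.vert_zero]
  · split_ifs with h
    · rw [show n - (b - a) = a by omega, he, show b = n by omega, w.vert_len]
    · rw [show n - (b - a) + (b - a) = n by omega, w.vert_len]
  · intro i hi hf
    rcases lt_trichotomy i a with h | h | h
    · rw [if_pos h] at hf
      rw [if_pos h.le, if_pos (by omega)]
      exact w.edge_fwd i (by omega) hf
    · subst h
      rw [if_neg (lt_irrefl _)] at hf
      rw [if_pos le_rfl, if_neg (by omega), he]
      have := w.edge_fwd _ (by omega) hf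
      rwa [show i + (b - i) = b by omega, show b + 1 = i + 1 + (b - i) by omega] at this
    · rw [if_neg (by omega)] at hf
      rw [if_neg (by omega), if_neg (by omega)]
      have := w.edge_fwd _ (by omega) hf
      rwa [show i + (b - a) + 1 = i + 1 + (b - a) by omega] at this
  · intro i hi hf
    rcases lt_trichotomy i a with h | h | h
    · rw [if_pos h] at hf
      rw [if_pos (show i + 1 ≤ a by omega), if_pos h.le]
      exact w.edge_bwd i (by omega) hf
    · subst h
      rw [if_neg (lt_irrefl _)] at hf
      rw [if_pos le_rfl, if_neg (by omega), he]
      have := w.edge_bwd _ (by omega) hf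
      rwa [show i + (b - i) = b by omega, show b + 1 = i + 1 + (b - i) by omega] at this
    · rw [if_neg (by omega)] at hf
      rw [if_neg (by omega), if_neg (by omega)]
      have := w.edge_bwd _ (by omega) hf
      rwa [show i + (b - a) + 1 = i + 1 + (b - a) by omega] at this
  · intro i hi hf hf'
    rcases lt_trichotomy (i + 1) a with h | h | h
    · rw [if_pos (by omega)] at hf hf'
      rw [if_pos (by omega)]
      exact w.collider i (by omega) hf hf'
    · subst h
      rw [if_pos (by omega)] at hf
      rw [if_neg (by omega), show i + 1 + (b - (i + 1)) = b by omega] at hf'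
      rw [if_pos le_rfl]
      cases hg : w.fwd (i + 1) with
      | true =>
        exact w.mem_an (b - (i + 1) - 1) (i + 1) (by omega) hg
          (by rwa [show i + 1 + (b - (i + 1) - 1) + 1 = b by omega])
      | false => exact w.collider i (by omega) hf hg
    · rw [if_neg (by omega)] at hf hf'
      rw [if_neg (by omega)]
      have := w.collider (i + (b - a)) (by omega) hf
        (by rwa [show i + (b - a) + 1 = i + 1 + (b - a) by omega])
      rwa [show i + (b - a) + 1 = i + 1 + (b - a) by omega] at this
  · intro i hi hf
    rcases lt_trichotomy (i + 1) a with h | h | h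
    · rw [if_pos (by omega), if_pos (by omega)] at hf
      rw [if_pos (by omega)]
      exact w.nonCollider i (by omega) hf
    · subst h
      rw [if_pos (by omega), if_neg (by omega), show i + 1 + (b - (i + 1)) = b by omega] at hf
      rw [if_pos le_rfl]
      cases hg : w.fwd i with
      | true =>
        obtain ⟨c, rfl⟩ : ∃ c, b = c + 1 := ⟨b - 1, by omega⟩
        rw [he]
        exact w.nonCollider c (by omega) fun hc => hf ⟨hg, hc.2⟩
      | false => exact w.nonCollider i (by omega) fun hc => by simp [hg] at hc
    · rw [if_neg (by omega), if_neg (by omega)] at hf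
      rw [if_neg (by omega)]
      have := w.nonCollider (i + (b - a)) (by omega)
        (by rwa [show i + (b - a) + 1 = i + 1 + (b - a) by omega])
      rwa [show i + (b - a) + 1 = i + 1 + (b - a) by omega] at this

/-- A shortest open walk is a path. -/
theorem OpenWalk.dConnected {n : ℕ} (w : G.OpenWalk S j k n) : G.DConnected j k S := by
  classical
  have hex : ∃ n, Nonempty (G.OpenWalk S j k n) := ⟨n, ⟨w⟩⟩
  obtain ⟨w⟩ := Nat.find_spec hex
  have hno : ∀ a b, a < b → b ≤ Nat.find hex → w.vert a ≠ w.vert b := fun a b hab hb he =>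
    Nat.find_min hex (by omega) (w.exists_shorter hab hb he)
  refine ⟨⟨Nat.find hex, w.vert, w.fwd, w.vert_zero, w.vert_len, ?_, w.edge_fwd, w.edge_bwd⟩,
    fun i hi => ⟨fun hc => w.collider i hi hc.1 hc.2, fun hc => w.nonCollider i hi hc⟩⟩
  intro a ha b hb he
  rcases lt_trichotomy a b with h | h | h
  · exact absurd he (hno a b h hb)
  · exact h
  · exact absurd he.symm (hno b a h ha)

/-- `Reach G S j x d`: some open walk leads from `j` to `x`, and its last edge points into `x` if
`d = true` and out of `x` if `d = false`. The walk without edges counts as pointing out of `j`,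
which gives the correct rule for leaving `j` when `j ∉ S`. -/
inductive Reach (G : DirGraph V) (S : Finset V) (j : V) : V → Bool → Prop
  | start : Reach G S j j false
  | step {x y : V} {b d : Bool} (hx : Reach G S j x b) (hf : d = true → G.Adj x y)
      (hb : d = false → G.Adj y x) (hc : b = true → d = false → x ∈ G.an S)
      (hn : ¬ (b = true ∧ d = false) → x ∉ S) : Reach G S j y d

theorem Reach.dConnected {b : Bool} (h : G.Reach S j k b) : G.DConnected j k S := by
  suffices ∃ n, ∃ w : G.OpenWalk S j k n, ∀ m, n = m + 1 → w.fwd m = b by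
    obtain ⟨n, w, -⟩ := this
    exact w.dConnected
  induction h with
  | start => exact ⟨0, ⟨fun _ => j, fun _ => true, rfl, rfl, by simp, by simp, by simp, by simp⟩,
      by simp⟩
  | @step x y b d hx hf hb hc hn ih =>
    obtain ⟨n, w, hw⟩ := ih
    refine ⟨n + 1, ⟨fun i => if i ≤ n then w.vert i else y,
      fun i => if i < n then w.fwd i else d, ?_, ?_, ?_, ?_, ?_, ?_⟩, ?_⟩
    · simp [w.vert_zero]
    · simp
    · intro i hi hf'
      rcases Nat.lt_or_ge i n with h | h
      · rw [if_pos h] at hf'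
        rw [if_pos h.le, if_pos (by omega)]
        exact w.edge_fwd i h hf'
      · rw [if_neg (by omega)] at hf'
        rw [if_pos (by omega), if_neg (by omega), show i = n by omega, w.vert_len]
        exact hf hf'
    · intro i hi hf'
      rcases Nat.lt_or_ge i n with h | h
      · rw [if_pos h] at hf'
        rw [if_pos (show i + 1 ≤ n by omega), if_pos h.le]
        exact w.edge_bwd i h hf'
      · rw [if_neg (by omega)] at hf'
        rw [if_neg (by omega), if_pos (by omega), show i = n by omega, w.vert_len]
        exact hb hf'
    · intro i hi h1 h2
      rw [if_pos (by omega)] at h1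
      rw [if_pos (by omega)]
      rcases Nat.lt_or_ge (i + 1) n with h | h
      · rw [if_pos h] at h2
        exact w.collider i h h1 h2
      · rw [if_neg (by omega)] at h2
        have hin : n = i + 1 := by omega
        rw [← hin, w.vert_len]
        exact hc ((hw i hin).symm.trans h1) h2
    · intro i hi h1
      rw [if_pos (by omega)] at h1
      rw [if_pos (by omega)]
      rcases Nat.lt_or_ge (i + 1) n with h | h
      · rw [if_pos h] at h1
        exact w.nonCollider i h h1
      · rw [if_neg (by omega)] at h1
        have hin : n = i + 1 := by omega
        rw [← hin, w.vert_len]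
        exact hn fun hc => h1 ⟨(hw i hin).trans hc.1, hc.2⟩
    · intro m hm
      simp [show ¬ m < n by omega]

theorem Reach.child {x y : V} {b : Bool} (h : G.Reach S j x b) (hx : x ∉ S) (hxy : G.Adj x y) :
    G.Reach S j y true :=
  h.step (fun _ => hxy) (by simp) (by simp) fun _ => hx

theorem Reach.parent {x y : V} (h : G.Reach S j x false) (hx : x ∉ S) (hxy : G.Adj y x) :
    G.Reach S j y false :=
  h.step (by simp) (fun _ => hxy) (by simp) fun _ => hx

theorem Reach.coparent {x y : V} (h : G.Reach S j x true) (hx : x ∈ G.an S) (hxy : G.Adj y x) :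
    G.Reach S j y false :=
  h.step (by simp) (fun _ => hxy) (fun _ _ => hx) (by simp)

/-- From a vertex `x ∉ S` of `an({j, k} ∪ S)` the walk can proceed to any parent of `x`, unless
there is an open walk to `k` anyway: if `x` would be a collider that is no ancestor of `S`, then a
directed path free of `S` leads from `x` to `k`, or from `x` to `j` and can be walked backwards. -/
theorem Reach.parent_of_ancestral {x y : V} {b : Bool} (hk : ¬ G.DConnected j k S)
    (h : G.Reach S j x b) (hj : j ∉ S)
    (hA : x ∈ G.an S ∨ x = j ∨ x = k ∨ G.IsAncestor x j ∨ G.IsAncestor x k)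
    (hxy : G.Adj y x) (hx : x ∉ S) : G.Reach S j y false := by
  cases b with
  | false => exact h.parent hx hxy
  | true =>
    by_cases han : x ∈ G.an S
    · exact h.coparent han hxy
    have hdesc : ∀ v, G.IsAncestor x v → v ∉ S := fun v hv hs => han (Or.inr ⟨v, hs, hv⟩)
    rcases hA with hA | rfl | rfl | hA | hA
    · exact absurd hA han
    · exact Reach.start.parent hx hxy
    · exact absurd h.dConnected hk
    · refine Reach.parent ?_ hx hxy
      have key : ∀ v, G.IsAncestor v j → (v = x ∨ G.IsAncestor x v) → G.Reach S j v false := by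
        intro v hv
        induction hv using Relation.TransGen.head_induction_on with
        | single h => exact fun _ => Reach.start.parent hj h
        | @head a c h _ ih =>
          intro ha
          have hc : G.IsAncestor x c := by
            rcases ha with rfl | ha
            · exact .single ‹_›
            · exact ha.tail ‹_›
          exact (ih (Or.inr hc)).parent (hdesc c hc) h
      exact key x hA (Or.inl rfl)
    · have key : ∀ v, G.IsAncestor x v → G.Reach S j v true := by
        intro v hv
        induction hv with
        | single h' => exact h.child hx h'
        | tail h1 h' ih => exact ih.child (hdesc _ h1) h'
      exact absurd (key k hA).dConnected hk

/-- Completeness of separation in the moral graph, for one step along a real or virtual edge inside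
`an({j, k} ∪ S)`. -/
theorem Reach.of_skeleton {x y : V} {b : Bool} (hk : ¬ G.DConnected j k S)
    (h : G.Reach S j x b) (hj : j ∉ S)
    (hA : x ∈ G.an S ∨ x = j ∨ x = k ∨ G.IsAncestor x j ∨ G.IsAncestor x k)
    (hB : y ∈ G.an S ∨ y = j ∨ y = k ∨ G.IsAncestor y j ∨ G.IsAncestor y k)
    (hx : x ∉ S) (hxy : G.skeleton.Adj x y) : ∃ d, G.Reach S j y d := by
  rcases hxy.2 with (hxy | hxy) | ⟨l, hxl, hyl, hl⟩
  · exact ⟨_, h.child hx hxy⟩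
  · exact ⟨_, h.parent_of_ancestral hk hj hA hxy hx⟩
  · have hr := h.child hx hxl
    have hup : ∀ v, G.IsAncestor l v →
        (v ∈ G.an S ∨ v = j ∨ v = k ∨ G.IsAncestor v j ∨ G.IsAncestor v k) →
        (l ∈ G.an S ∨ l = j ∨ l = k ∨ G.IsAncestor l j ∨ G.IsAncestor l k) := by
      rintro v hlv ((hv | ⟨s, hs, hv⟩) | rfl | rfl | hv | hv)
      · exact Or.inl (Or.inr ⟨v, hv, hlv⟩)
      · exact Or.inl (Or.inr ⟨s, hs, hlv.trans hv⟩)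
      · exact Or.inr (Or.inr (Or.inr (Or.inl hlv)))
      · exact Or.inr (Or.inr (Or.inr (Or.inr hlv)))
      · exact Or.inr (Or.inr (Or.inr (Or.inl (hlv.trans hv))))
      · exact Or.inr (Or.inr (Or.inr (Or.inr (hlv.trans hv))))
    by_cases hlS : l ∈ S
    · exact ⟨_, hr.coparent (Or.inl hlS) hyl⟩
    · exact ⟨_, hr.parent_of_ancestral hk hj (hl.elim (hup x · hA) (hup y · hB)) hyl hlS⟩

/-- Really or virtually adjacent vertices are not d-separated by any set. -/
theorem not_dSeparated_of_skeleton (h : G.skeleton.Adj j k) (hj : j ∉ S) :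
    ¬ G.DSeparated j k S := fun hs => by
  obtain ⟨d, hd⟩ := Reach.of_skeleton hs .start hj (Or.inr (Or.inl rfl))
    (Or.inr (Or.inr (Or.inl rfl))) hj h
  exact hs hd.dConnected

/-- If `S` d-separates two vertices, then a skeleton neighbour `v ∉ S` of both is no ancestor of
them or of `S`. -/
theorem DSeparated.not_ancestor {v : V} (hs : G.DSeparated j k S) (hj : j ∉ S)
    (hjv : G.skeleton.Adj j v) (hvk : G.skeleton.Adj v k) (hv : v ∉ S) :
    ¬ (v ∈ G.an S ∨ G.IsAncestor v j ∨ G.IsAncestor v k) := fun hA => by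
  have hA' : v ∈ G.an S ∨ v = j ∨ v = k ∨ G.IsAncestor v j ∨ G.IsAncestor v k := by tauto
  obtain ⟨d, hd⟩ := Reach.of_skeleton hs .start hj (Or.inr (Or.inl rfl)) hA' hj hjv
  obtain ⟨d, hd⟩ := hd.of_skeleton hs hj hA' (Or.inr (Or.inr (Or.inl rfl))) hv hvk
  exact hs hd.dConnected

theorem isAncestor_of_skeleton {u v : V} (h : G.skeleton.Adj u v) (hv : ¬ G.IsAncestor v u) :
    G.IsAncestor u v := by
  rcases h.2 with (h | h) | ⟨l, h1, h2, h3⟩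
  · exact .single h
  · exact absurd (.single h) hv
  · rcases h3 with h3 | h3
    · exact absurd (h3.head h2) hv
    · exact h3.head h1

/-- A pair outside the skeleton is d-separated by its proper ancestors. -/
theorem exists_dSeparated_of_not_skeleton [Finite V] (hne : j ≠ k) (h : ¬ G.skeleton.Adj j k) :
    ∃ S : Finset V, G.DSeparated j k S ∧
      ∀ v, v ∈ S ↔ v ≠ j ∧ v ≠ k ∧ (G.IsAncestor v j ∨ G.IsAncestor v k) := by
  refine ⟨(Set.toFinite {v | v ≠ j ∧ v ≠ k ∧ (G.IsAncestor v j ∨ G.IsAncestor v k)}).toFinset, ?_,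
    by simp⟩
  have hr : ¬ (G.ReallyAdjacent j k ∨ G.VirtuallyAdjacent j k) := fun h' => h ⟨hne, h'⟩
  refine dSeparated_of_ancestral
    (A := {v | v = j ∨ v = k ∨ G.IsAncestor v j ∨ G.IsAncestor v k}) ?_ (by simp) (by simp)
    ?_ hne (by simp) ?_
  · rintro u v (rfl | rfl | hv | hv) huv
    · exact Or.inr (Or.inr (Or.inl (.single huv)))
    · exact Or.inr (Or.inr (Or.inr (.single huv)))
    · exact Or.inr (Or.inr (Or.inl (hv.head huv)))
    · exact Or.inr (Or.inr (Or.inr (hv.head huv)))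
  · intro s hs
    simp only [Set.Finite.mem_toFinset, Set.mem_ofPred_eq] at hs ⊢
    tauto
  · intro v hv hvS hvj
    have hvk : v = k := by
      simp only [Set.Finite.mem_toFinset, Set.mem_ofPred_eq] at hv hvS
      tauto
    subst hvk
    refine ⟨fun h1 => hr (Or.inl (Or.inl h1)), fun h1 => hr (Or.inl (Or.inr h1)), ?_⟩
    rintro l (rfl | rfl | hl | hl) h1 h2
    · exact G.loopless _ h1
    · exact G.loopless _ h2
    · exact hr (Or.inr ⟨l, h1, h2, Or.inl hl⟩)
    · exact hr (Or.inr ⟨l, h1, h2, Or.inr hl⟩)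

end Separation

end DirGraph

/-! ### Rules, edges and Markov equivalence -/

namespace DirGraph

section Rules

variable {V : Type*} {G H : DirGraph V}

theorem mem_dsep {j k : V} {S : Finset V} :
    (s(j, k), S) ∈ G.dsep ↔ j ≠ k ∧ j ∉ S ∧ k ∉ S ∧ G.DSeparated j k S := by
  constructor
  · rintro ⟨a, b, hab, h1, h2, h3, h4⟩
    rcases Sym2.eq_iff.1 hab with ⟨rfl, rfl⟩ | ⟨rfl, rfl⟩
    · exact ⟨h1, h2, h3, h4⟩
    · exact ⟨h1.symm, h3, h2, dSeparated_comm.1 h4⟩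
  · exact fun h => ⟨j, k, rfl, h⟩

theorem not_skeleton_of_mem_dsep {j k : V} {S : Finset V} (h : (s(j, k), S) ∈ G.dsep) :
    ¬ G.skeleton.Adj j k := fun hs =>
  not_dSeparated_of_skeleton hs (mem_dsep.1 h).2.1 (mem_dsep.1 h).2.2.2

theorem exists_mem_dsep [Finite V] {j k : V} (hne : j ≠ k) (h : ¬ G.skeleton.Adj j k) :
    ∃ S, (s(j, k), S) ∈ G.dsep ∧
      ∀ v, v ∈ S ↔ v ≠ j ∧ v ≠ k ∧ (G.IsAncestor v j ∨ G.IsAncestor v k) := by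
  obtain ⟨S, hS, hm⟩ := exists_dSeparated_of_not_skeleton hne h
  exact ⟨S, mem_dsep.2 ⟨hne, by simp [hm], by simp [hm], hS⟩, hm⟩

/-- The skeleton consists of the pairs about which there is no d-separation rule. -/
theorem numEdges_add_ncard_fst [Finite V] (G : DirGraph V) :
    G.numEdges + (Prod.fst '' G.dsep).ncard = {e : Sym2 V | ¬ e.IsDiag}.ncard := by
  rw [numEdges, ← Set.ncard_union_eq _ (Set.toFinite _) (Set.toFinite _)]
  · congr 1
    ext e
    induction e using Sym2.ind with
    | _ j k =>
      simp only [Set.mem_union, SimpleGraph.mem_edgeSet, Set.mem_image, Prod.exists,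
        exists_and_right, exists_eq_right, Set.mem_ofPred_eq, Sym2.mk_isDiag_iff]
      constructor
      · rintro (h | ⟨S, h⟩)
        · exact h.ne
        · exact (mem_dsep.1 h).1
      · intro hne
        by_contra! h
        obtain ⟨S, hS, -⟩ := exists_mem_dsep hne h.1
        exact h.2 S hS
  · rw [Set.disjoint_left]
    intro e
    induction e using Sym2.ind with
    | _ j k =>
      rintro h ⟨⟨e, S⟩, hS, rfl⟩
      exact not_skeleton_of_mem_dsep hS h

theorem numEdges_lt_of_ncard_fst_lt [Finite V]
    (h : (Prod.fst '' H.dsep).ncard < (Prod.fst '' G.dsep).ncard) : G.numEdges < H.numEdges := by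
  have h1 := G.numEdges_add_ncard_fst
  have h2 := H.numEdges_add_ncard_fst
  omega

end Rules

end DirGraph

open DirGraph

section Models

variable {V : Type*} [Fintype V] {G H : DirGraph V} {P : ProbabilityMeasure (V → ℝ)}

theorem markovEquiv_of_dsep_eq (h : G.dsep = H.dsep) : MarkovEquiv G H := by
  have key : ∀ {G H : DirGraph V} (_ : G.dsep = H.dsep) (P : ProbabilityMeasure (V → ℝ)),
      CMC G P → CMC H P := by
    intro G H h P hG j k S hjk hj hk hs
    have : (s(j, k), S) ∈ G.dsep := h ▸ mem_dsep.2 ⟨hjk, hj, hk, hs⟩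
    exact hG j k S hjk hj hk (mem_dsep.1 this).2.2.2
  exact fun P => ⟨key h P, key h.symm P⟩

theorem cmc_iff_dsep_subset {U : Set (Sym2 V × Finset V)}
    (hP : ∀ j k S, j ≠ k → j ∉ S → k ∉ S → (CIStatement P j k S ↔ (s(j, k), S) ∈ U)) :
    CMC G P ↔ G.dsep ⊆ U := by
  constructor
  · rintro hG ⟨e, S⟩ he
    induction e using Sym2.ind with
    | _ j k =>
      obtain ⟨h1, h2, h3, h4⟩ := mem_dsep.1 he
      exact (hP j k S h1 h2 h3).1 (hG j k S h1 h2 h3 h4)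
  · intro hG j k S h1 h2 h3 h4
    exact (hP j k S h1 h2 h3).2 (hG (mem_dsep.2 ⟨h1, h2, h3, h4⟩))

end Models

/-! ### Two incompatible families of rules -/

section Families

variable {V : Type*}

/-- The four rules making the vertex `3` independent of `{0, 4}`; `c` embeds the five vertices in
`V`. They concern only two pairs. -/
def rules₁ (c : Fin 5 → V) : Set (Sym2 V × Finset V) :=
  {(s(c 0, c 3), ∅), (s(c 0, c 3), {c 4}), (s(c 3, c 4), ∅), (s(c 3, c 4), {c 0})}

/-- Three rules about three different pairs: `0` and `3` are independent, `1` and `2` are so given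
`{0, 3}`, and `0` and `4` are so given `{1, 2, 3}`. -/
def rules₂ [DecidableEq V] (c : Fin 5 → V) : Set (Sym2 V × Finset V) :=
  {(s(c 0, c 3), ∅), (s(c 0, c 4), {c 1, c 2, c 3}), (s(c 1, c 2), {c 0, c 3})}

theorem ncard_rules₁ {c : Fin 5 → V} (hc : Function.Injective c) : (rules₁ c).ncard = 4 := by
  have h : ∀ i j, c i = c j ↔ i = j := fun i j => hc.eq_iff
  rw [rules₁, Set.ncard_insert_of_notMem, Set.ncard_insert_of_notMem, Set.ncard_pair] <;>
    simp [h, Finset.ext_iff]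

theorem ncard_rules₂_le [DecidableEq V] (c : Fin 5 → V) : (rules₂ c).ncard ≤ 3 := by
  have h : rules₂ c = (({(s(c 0, c 3), ∅), (s(c 0, c 4), {c 1, c 2, c 3}),
    (s(c 1, c 2), {c 0, c 3})} : Finset (Sym2 V × Finset V)) : Set _) := by simp [rules₂]
  rw [h, Set.ncard_coe_finset]
  exact Finset.card_le_three

theorem ncard_fst_rules₂ [DecidableEq V] {c : Fin 5 → V} (hc : Function.Injective c) :
    (Prod.fst '' rules₂ c).ncard = 3 := by
  have h : ∀ i j, c i = c j ↔ i = j := fun i j => hc.eq_iff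
  rw [rules₂, Set.image_insert_eq, Set.image_pair, Set.ncard_insert_of_notMem, Set.ncard_pair] <;>
    simp [h]

theorem ncard_fst_rules₁_le (c : Fin 5 → V) : (Prod.fst '' rules₁ c).ncard ≤ 2 := by
  have h : Prod.fst '' rules₁ c = {s(c 0, c 3), s(c 3, c 4)} := by
    simp [rules₁, Set.image_insert_eq]
  rw [h]
  exact (Set.ncard_insert_le _ _).trans (by simp)

/-- A directed graph whose rules all belong to the two families either has exactly the second
family as its rules, or it has rules about at most two pairs, and then less than four rules unless
it has exactly the first family. The reason is that the following are incompatible, where `v ⇝ w`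
stands for ancestry:
* a rule on `3, 4` and the rule on `1, 2`, as the former gives `4 ⇝ 1` and the latter forbids it;
* the rule `0, 3 | 4` and the rule on `1, 2`, as the latter gives `1 ⇝ 4` and the former forbids it;
* rules on `0, 3`, on `3, 4` and on `0, 4`, as the first two forbid `1 ⇝ 0` and `1 ⇝ 4`, while the
  proper ancestors of `0` and `4`, being a separating set, have to be `1, 2, 3`. -/
theorem dsep_eq_or_of_subset_rules [Finite V] [DecidableEq V] {c : Fin 5 → V}
    (hc : Function.Injective c) {H : DirGraph V} (hH : H.dsep ⊆ rules₁ c ∪ rules₂ c) :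
    H.dsep = rules₂ c ∨
      (Prod.fst '' H.dsep).ncard ≤ 2 ∧ (H.dsep = rules₁ c ∨ H.dsep.ncard ≤ 3) := by
  have h : ∀ i j, c i = c j ↔ i = j := fun i j => hc.eq_iff
  have hU : ∀ r ∈ H.dsep, r = (s(c 0, c 3), ∅) ∨ r = (s(c 0, c 3), {c 4}) ∨
      r = (s(c 3, c 4), ∅) ∨ r = (s(c 3, c 4), {c 0}) ∨ r = (s(c 0, c 4), {c 1, c 2, c 3}) ∨
      r = (s(c 1, c 2), {c 0, c 3}) := by
    intro r hr
    have := hH hr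
    simp only [rules₁, rules₂, Set.mem_union, Set.mem_insert_iff, Set.mem_singleton_iff] at this
    tauto
  have hadj : ∀ i j : Fin 5, i ≠ j → s(i, j) ≠ s(0, 3) → s(i, j) ≠ s(3, 4) → s(i, j) ≠ s(0, 4) →
      s(i, j) ≠ s(1, 2) → H.skeleton.Adj (c i) (c j) := by
    intro i j hij h1 h2 h3 h4
    by_contra hn
    obtain ⟨S, hS, -⟩ := exists_mem_dsep (fun he => hij (hc he)) hn
    have hm : ∀ a b : Fin 5, s(c i, c j) = s(c a, c b) → s(i, j) = s(a, b) := by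
      intro a b hab
      simpa [Sym2.eq_iff, h] using hab
    rcases hU _ hS with he | he | he | he | he | he <;>
      · have := hm _ _ (congrArg Prod.fst he)
        contradiction
  -- A rule about `i, j` makes a common skeleton neighbour outside `S` a strict descendant of both.
  have hdesc : ∀ (i j v : Fin 5) (S : Finset V), (s(c i, c j), S) ∈ H.dsep →
      H.skeleton.Adj (c i) (c v) → H.skeleton.Adj (c v) (c j) → c v ∉ S →
      c v ∉ H.an S ∧ ¬ H.IsAncestor (c v) (c i) ∧ ¬ H.IsAncestor (c v) (c j) ∧
        H.IsAncestor (c i) (c v) ∧ H.IsAncestor (c j) (c v) := by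
    intro i j v S hS h1 h2 hv
    have hn := (mem_dsep.1 hS).2.2.2.not_ancestor (mem_dsep.1 hS).2.1 h1 h2 hv
    push Not at hn
    exact ⟨hn.1, hn.2.1, hn.2.2, isAncestor_of_skeleton h1 hn.2.1,
      isAncestor_of_skeleton h2.symm hn.2.2⟩
  have h01 := hadj 0 1 (by decide) (by decide) (by decide) (by decide) (by decide)
  have h13 := hadj 1 3 (by decide) (by decide) (by decide) (by decide) (by decide)
  have h14 := hadj 1 4 (by decide) (by decide) (by decide) (by decide) (by decide)
  have h24 := hadj 2 4 (by decide) (by decide) (by decide) (by decide) (by decide)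
  have hp : ∀ S, (s(c 0, c 3), S) ∈ H.dsep → c 1 ∉ H.an S ∧ ¬ H.IsAncestor (c 1) (c 0) := by
    intro S hS
    have hS1 : c 1 ∉ S := by
      rcases hU _ hS with he | he | he | he | he | he <;>
        simp [h] at he <;> simp [he, h]
    have := hdesc 0 3 1 S hS h01 h13 hS1
    exact ⟨this.1, this.2.1⟩
  have hq : ∀ S, (s(c 3, c 4), S) ∈ H.dsep →
      H.IsAncestor (c 4) (c 1) ∧ ¬ H.IsAncestor (c 1) (c 4) := by
    intro S hS
    have hS1 : c 1 ∉ S := by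
      rcases hU _ hS with he | he | he | he | he | he <;>
        simp [h] at he <;> simp [he, h]
    have := hdesc 3 4 1 S hS h13.symm h14 hS1
    exact ⟨this.2.2.2.2, this.2.2.1⟩
  by_cases hs : (s(c 1, c 2), {c 0, c 3}) ∈ H.dsep
  · have hs' := hdesc 1 2 4 _ hs h14 h24.symm (by simp [h])
    have hsub : H.dsep ⊆ rules₂ c := by
      intro r hr
      rcases hU r hr with rfl | rfl | rfl | rfl | rfl | rfl
      · simp [rules₂]
      · exact absurd (Or.inr ⟨c 4, by simp, hs'.2.2.2.1⟩) (hp _ hr).1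
      · exact absurd (hq _ hr).1 hs'.2.1
      · exact absurd (hq _ hr).1 hs'.2.1
      · simp [rules₂]
      · simp [rules₂]
    rcases hsub.eq_or_ssubset with he | hlt
    · exact Or.inl he
    · have h1 := Set.ncard_lt_ncard hlt (Set.toFinite _)
      have h2 := ncard_rules₂_le c
      have h3 := Set.ncard_image_le (f := Prod.fst) (Set.toFinite H.dsep)
      exact Or.inr ⟨by omega, Or.inr (by omega)⟩
  right
  by_cases hr : (s(c 0, c 4), {c 1, c 2, c 3}) ∈ H.dsep
  · obtain ⟨S, hS, hm⟩ := exists_mem_dsep (mem_dsep.1 hr).1 (not_skeleton_of_mem_dsep hr)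
    have h1S : c 1 ∈ S := by
      rcases hU _ hS with he | he | he | he | he | he <;>
        simp [h] at he
      simp [he]
    have h1 := ((hm _).1 h1S).2.2
    have hpq : (∀ S, (s(c 0, c 3), S) ∉ H.dsep) ∨ ∀ S, (s(c 3, c 4), S) ∉ H.dsep := by
      by_contra! hcon
      obtain ⟨⟨S, hS⟩, ⟨T, hT⟩⟩ := hcon
      exact h1.elim (hp _ hS).2 (hq _ hT).2
    have hle : ∀ a b d : Sym2 V × Finset V, a.1 = b.1 → H.dsep ⊆ {a, b, d} →
        (Prod.fst '' H.dsep).ncard ≤ 2 ∧ H.dsep.ncard ≤ 3 := by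
      intro a b d hab hsub
      constructor
      · refine (Set.ncard_le_ncard (t := {b.1, d.1}) ?_ (Set.toFinite _)).trans
          ((Set.ncard_insert_le _ _).trans (by simp))
        refine (Set.image_mono hsub).trans ?_
        simp [Set.image_insert_eq, hab]
      · refine (Set.ncard_le_ncard (t := (({a, b, d} : Finset _) : Set _)) (by simpa using hsub)
          (Set.toFinite _)).trans ?_
        rw [Set.ncard_coe_finset]
        exact Finset.card_le_three
    rcases hpq with hn | hn
    · refine (hle (s(c 3, c 4), ∅) (s(c 3, c 4), {c 0}) (s(c 0, c 4), {c 1, c 2, c 3}) rfl ?_).imp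
        id Or.inr
      intro r hr
      rcases hU r hr with rfl | rfl | rfl | rfl | rfl | rfl
      · exact absurd hr (hn _)
      · exact absurd hr (hn _)
      · simp
      · simp
      · simp
      · exact absurd hr hs
    · refine (hle (s(c 0, c 3), ∅) (s(c 0, c 3), {c 4}) (s(c 0, c 4), {c 1, c 2, c 3}) rfl ?_).imp
        id Or.inr
      intro r hr
      rcases hU r hr with rfl | rfl | rfl | rfl | rfl | rfl
      · simp
      · simp
      · exact absurd hr (hn _)
      · exact absurd hr (hn _)
      · simp
      · exact absurd hr hs
  · have hsub : H.dsep ⊆ rules₁ c := by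
      intro r hr'
      rcases hU r hr' with rfl | rfl | rfl | rfl | rfl | rfl
      · simp [rules₁]
      · simp [rules₁]
      · simp [rules₁]
      · simp [rules₁]
      · exact absurd hr' hr
      · exact absurd hr' hs
    refine ⟨(Set.ncard_le_ncard (Set.image_mono hsub) (Set.toFinite _)).trans
      (ncard_fst_rules₁_le c), ?_⟩
    rcases hsub.eq_or_ssubset with he | hlt
    · exact Or.inl he
    · have h1 := Set.ncard_lt_ncard hlt (Set.toFinite _)
      rw [ncard_rules₁ hc] at h1
      exact Or.inr (by omega)

/-- If the conditional independence statements of `P` are exactly the rules of the two families,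
and two graphs entail exactly the first and the second family, then the first graph is optimal
with respect to the number of rules and the second with respect to the number of edges. -/
theorem incomparable_of_rules [Fintype V] [DecidableEq V] {c : Fin 5 → V}
    (hc : Function.Injective c) {P : ProbabilityMeasure (V → ℝ)} {G₁ G₂ : DirGraph V}
    (hP : ∀ j k S, j ≠ k → j ∉ S → k ∉ S →
      (CIStatement P j k S ↔ (s(j, k), S) ∈ rules₁ c ∪ rules₂ c))
    (h₁ : G₁.dsep = rules₁ c) (h₂ : G₂.dsep = rules₂ c) (hne : ¬ MarkovEquiv G₁ G₂)
    {C : Set (DirGraph V)} (hC₁ : G₁ ∈ C) (hC₂ : G₂ ∈ C) :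
    (IdentifiableSMR C G₂ P ∧ ¬ MDR C G₂ P) ∧ (MDR C G₁ P ∧ ¬ WeakSMR C G₁ P) := by
  have hcmc : ∀ G : DirGraph V, CMC G P ↔ G.dsep ⊆ rules₁ c ∪ rules₂ c := fun G =>
    cmc_iff_dsep_subset hP
  have hG₁ : CMC G₁ P := (hcmc _).2 (h₁ ▸ Set.subset_union_left)
  have hG₂ : CMC G₂ P := (hcmc _).2 (h₂ ▸ Set.subset_union_right)
  have hf₁ := ncard_fst_rules₁_le c
  have hf₂ := ncard_fst_rules₂ hc
  have hr₁ := ncard_rules₁ hc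
  have hr₂ := ncard_rules₂_le c
  have hne' : ¬ MarkovEquiv G₂ G₁ := fun h => hne fun Q => (h Q).symm
  refine ⟨⟨⟨hG₂, fun H _ hH hHG => ?_⟩, fun h => ?_⟩, ⟨hG₁, fun H _ hH hHG => ?_⟩, fun h => ?_⟩
  · apply numEdges_lt_of_ncard_fst_lt
    rcases dsep_eq_or_of_subset_rules hc ((hcmc H).1 hH) with he | he
    · exact absurd (markovEquiv_of_dsep_eq (he.trans h₂.symm)) hHG
    · rw [h₂]
      omega
  · have := h.2 G₁ hC₁ hG₁ hne
    rw [numRules, numRules, h₁, h₂] at this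
    omega
  · rw [numRules, numRules, h₁]
    rcases dsep_eq_or_of_subset_rules hc ((hcmc H).1 hH) with he | ⟨-, he | he⟩
    · rw [he]
      omega
    · exact absurd (markovEquiv_of_dsep_eq (he.trans h₁.symm)) hHG
    · omega
  · have := h.2 G₂ hC₂ hG₂ hne'
    have hlt : G₂.numEdges < G₁.numEdges := numEdges_lt_of_ncard_fst_lt (by rw [h₁, h₂]; omega)
    omega

end Families

/-! ### The two graphs -/

namespace DirGraph

/-- The graph whose rules are the first family: on the vertices below `5` it has the edges
`0 → 1, 2, 4`, `3 → 1, 2`, `4 → 1, 2` and `1 → 2`. Every further vertex is a child of all the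
vertices below it, and for `n ≥ 12` the edge `11 → 10` creates a two-cycle. -/
def graph₁ (n : ℕ) : DirGraph (Fin n) where
  Adj j k :=
    ((j : ℕ) = 0 ∧ ((k : ℕ) = 1 ∨ (k : ℕ) = 2 ∨ (k : ℕ) = 4) ∨ (j : ℕ) = 1 ∧ (k : ℕ) = 2 ∨
      ((j : ℕ) = 3 ∨ (j : ℕ) = 4) ∧ ((k : ℕ) = 1 ∨ (k : ℕ) = 2)) ∨
    (5 ≤ (k : ℕ) ∧ (j : ℕ) < k) ∨ ((j : ℕ) = 11 ∧ (k : ℕ) = 10)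
  loopless v := by omega

/-- The graph whose rules are the second family: on the vertices below `5` it has the edges
`0 → 1, 2`, `3 → 1, 2` and `1, 2, 3 → 4`; the further vertices are as in `graph₁`. -/
def graph₂ (n : ℕ) : DirGraph (Fin n) where
  Adj j k :=
    (((j : ℕ) = 0 ∨ (j : ℕ) = 3) ∧ ((k : ℕ) = 1 ∨ (k : ℕ) = 2) ∨
      ((j : ℕ) = 1 ∨ (j : ℕ) = 2 ∨ (j : ℕ) = 3) ∧ (k : ℕ) = 4) ∨
    (5 ≤ (k : ℕ) ∧ (j : ℕ) < k) ∨ ((j : ℕ) = 11 ∧ (k : ℕ) = 10)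
  loopless v := by omega

theorem graph₁_adj {n : ℕ} {j k : Fin n} : (graph₁ n).Adj j k ↔
    ((j : ℕ) = 0 ∧ ((k : ℕ) = 1 ∨ (k : ℕ) = 2 ∨ (k : ℕ) = 4) ∨ (j : ℕ) = 1 ∧ (k : ℕ) = 2 ∨
      ((j : ℕ) = 3 ∨ (j : ℕ) = 4) ∧ ((k : ℕ) = 1 ∨ (k : ℕ) = 2)) ∨
    (5 ≤ (k : ℕ) ∧ (j : ℕ) < k) ∨ ((j : ℕ) = 11 ∧ (k : ℕ) = 10) := Iff.rfl

theorem graph₂_adj {n : ℕ} {j k : Fin n} : (graph₂ n).Adj j k ↔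
    (((j : ℕ) = 0 ∨ (j : ℕ) = 3) ∧ ((k : ℕ) = 1 ∨ (k : ℕ) = 2) ∨
      ((j : ℕ) = 1 ∨ (j : ℕ) = 2 ∨ (j : ℕ) = 3) ∧ (k : ℕ) = 4) ∨
    (5 ≤ (k : ℕ) ∧ (j : ℕ) < k) ∨ ((j : ℕ) = 11 ∧ (k : ℕ) = 10) := Iff.rfl

instance (n : ℕ) : DecidableRel (graph₁ n).Adj := fun _ _ => decidable_of_iff' _ graph₁_adj

instance (n : ℕ) : DecidableRel (graph₂ n).Adj := fun _ _ => decidable_of_iff' _ graph₂_adj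

theorem isAcyclic_of_lt {V : Type*} {G : DirGraph V} (f : V → ℕ)
    (hf : ∀ u v, G.Adj u v → f u < f v) : G.IsAcyclic := by
  intro v hv
  have key : ∀ u w, G.IsAncestor u w → f u < f w := by
    intro u w h
    induction h with
    | single h => exact hf _ _ h
    | tail _ h ih => exact ih.trans (hf _ _ h)
  exact lt_irrefl _ (key v v hv)

theorem graph₁_five_isAcyclic : (graph₁ 5).IsAcyclic := by
  refine isAcyclic_of_lt (![0, 2, 3, 0, 1] : Fin 5 → ℕ) fun u v h => ?_
  rw [graph₁_adj] at h
  revert u v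
  decide

theorem graph₂_five_isAcyclic : (graph₂ 5).IsAcyclic := by
  refine isAcyclic_of_lt (![0, 1, 1, 0, 2] : Fin 5 → ℕ) fun u v h => ?_
  rw [graph₂_adj] at h
  revert u v
  decide

theorem graph₁_twelve_not_isAcyclic : ¬ (graph₁ 12).IsAcyclic := fun h =>
  h 10 (.tail (.single (graph₁_adj.2 (by decide)))
    (graph₁_adj.2 (by decide) : (graph₁ 12).Adj 11 10))

theorem graph₂_twelve_not_isAcyclic : ¬ (graph₂ 12).IsAcyclic := fun h =>
  h 10 (.tail (.single (graph₂_adj.2 (by decide)))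
    (graph₂_adj.2 (by decide) : (graph₂ 12).Adj 11 10))

/-- A common child in `an(S)` is an active collider. -/
theorem DSeparated.not_mem_an {V : Type*} {G : DirGraph V} {j k l : V} {S : Finset V}
    (h : G.DSeparated j k S) (hj : j ∉ S) (hjl : G.Adj j l) (hkl : G.Adj k l) : l ∉ G.an S :=
  fun hl => h ((Reach.start.child hj hjl).coparent hl hkl).dConnected

theorem not_adj_of_mem_dsep {V : Type*} {G : DirGraph V} {j k : V} {S : Finset V}
    (h : (s(j, k), S) ∈ G.dsep) : ¬ G.Adj j k ∧ ¬ G.Adj k j :=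
  ⟨fun hjk => not_skeleton_of_mem_dsep h ⟨(mem_dsep.1 h).1, Or.inl (Or.inl hjk)⟩,
    fun hkj => not_skeleton_of_mem_dsep h ⟨(mem_dsep.1 h).1, Or.inl (Or.inr hkj)⟩⟩

/-- To bound the rules of a graph on `Fin n` it suffices to look at the pairs `j < k`. -/
theorem dsep_subset_of_lt {n : ℕ} {G : DirGraph (Fin n)} {U : Set (Sym2 (Fin n) × Finset (Fin n))}
    (h : ∀ j k S, j < k → (s(j, k), S) ∈ G.dsep → (s(j, k), S) ∈ U) : G.dsep ⊆ U := by
  rintro ⟨e, S⟩ he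
  induction e using Sym2.ind with
  | _ j k =>
    rcases lt_trichotomy j k with hjk | hjk | hjk
    · exact h j k S hjk he
    · exact absurd hjk (mem_dsep.1 he).1
    · have hsw : (s(j, k), S) = (s(k, j), S) := by rw [Sym2.eq_swap]
      rw [hsw] at he ⊢
      exact h k j S hjk he

/-- The criterion `dSeparated_of_ancestral` for a graph on `Fin n` in which no edge enters the first
five vertices from outside: only the edges among these matter. -/
theorem mem_dsep_castLE {n : ℕ} (hn : 5 ≤ n) {G : DirGraph (Fin n)} {g : DirGraph (Fin 5)}
    (hG : ∀ u v, G.Adj (Fin.castLE hn u) (Fin.castLE hn v) ↔ g.Adj u v)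
    (hlow : ∀ u v : Fin n, (v : ℕ) < 5 → G.Adj u v → (u : ℕ) < 5)
    {j k : Fin 5} {S A : Finset (Fin 5)}
    (h : (∀ u v, v ∈ A → g.Adj u v → u ∈ A) ∧ j ∈ A ∧ k ∈ A ∧ S ⊆ A ∧ j ≠ k ∧ j ∉ S ∧ k ∉ S ∧
      ∀ v ∈ A, v ∉ S → v ≠ j → ¬ g.Adj j v ∧ ¬ g.Adj v j ∧ ∀ l ∈ A, g.Adj j l → ¬ g.Adj v l) :
    (s(Fin.castLE hn j, Fin.castLE hn k), S.map (Fin.castLEEmb hn)) ∈ G.dsep := by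
  obtain ⟨h1, h2, h3, h4, h5, h6, h7, h8⟩ := h
  refine mem_dsep.2 ⟨by simpa using h5, by simpa using h6, by simpa using h7, ?_⟩
  refine dSeparated_of_ancestral (A := {v | ∃ a ∈ A, Fin.castLE hn a = v}) ?_ ⟨j, h2, rfl⟩
    ⟨k, h3, rfl⟩ ?_ (by simpa using h5) (by simpa using h7) ?_
  · rintro u _ ⟨a, ha, rfl⟩ huv
    have hu := hlow _ _ a.2 huv
    exact ⟨⟨u, hu⟩, h1 _ _ ha ((hG ⟨u, hu⟩ a).1 huv), rfl⟩
  · intro s hs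
    obtain ⟨a, ha, rfl⟩ := Finset.mem_map.1 hs
    exact ⟨a, h4 ha, rfl⟩
  · rintro _ ⟨a, ha, rfl⟩ haS haj
    obtain ⟨h9, h10, h11⟩ := h8 a ha (fun h => haS (Finset.mem_map.2 ⟨a, h, rfl⟩))
      (fun h => haj (h ▸ rfl))
    refine ⟨fun h => h9 ((hG _ _).1 h), fun h => h10 ((hG _ _).1 h), ?_⟩
    rintro _ ⟨l, hl, rfl⟩ hjl hal
    exact h11 l hl ((hG _ _).1 hjl) ((hG _ _).1 hal)

theorem graph₁_dsep {n : ℕ} (hn : 5 ≤ n) : (graph₁ n).dsep = rules₁ (Fin.castLE hn) := by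
  apply Set.Subset.antisymm
  · refine dsep_subset_of_lt fun j k S hjk he => ?_
    obtain ⟨hne, hj, hk, hs⟩ := mem_dsep.1 he
    have hna := not_adj_of_mem_dsep he
    have hnS : ∀ v ∈ S, ¬ ((graph₁ n).Adj j v ∧ (graph₁ n).Adj k v) := fun v hv h =>
      hs.not_mem_an hj h.1 h.2 (Or.inl hv)
    have hk5 : (k : ℕ) < 5 := not_le.1 fun h => hna.1 (graph₁_adj.2 (Or.inr (Or.inl ⟨h, hjk⟩)))
    have hcase : ∀ a b : Fin 5, a < b → ¬ (graph₁ 5).Adj a b ∧ ¬ (graph₁ 5).Adj b a →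
      (a : ℕ) = 0 ∧ (b : ℕ) = 3 ∨ (a : ℕ) = 3 ∧ (b : ℕ) = 4 := by decide
    replace hcase : (j : ℕ) = 0 ∧ (k : ℕ) = 3 ∨ (j : ℕ) = 3 ∧ (k : ℕ) = 4 :=
      hcase ⟨j, Nat.lt_trans hjk hk5⟩ ⟨k, hk5⟩ hjk hna
    simp only [graph₁_adj] at hnS
    rcases hcase with ⟨h1, h2⟩ | ⟨h1, h2⟩
    · obtain rfl : j = Fin.castLE hn 0 := Fin.ext h1
      obtain rfl : k = Fin.castLE hn 3 := Fin.ext h2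
      have hS : S ⊆ {Fin.castLE hn 4} := by
        intro v hv
        have hvj : (v : ℕ) ≠ 0 := fun h =>
          hj (by rwa [show Fin.castLE hn 0 = v from Fin.ext h.symm])
        have hvk : (v : ℕ) ≠ 3 := fun h =>
          hk (by rwa [show Fin.castLE hn 3 = v from Fin.ext h.symm])
        have := hnS v hv
        exact Finset.mem_singleton.2 (Fin.ext (show (v : ℕ) = 4 by omega))
      rcases Finset.subset_singleton_iff.1 hS with rfl | rfl <;> simp [rules₁]
    · obtain rfl : j = Fin.castLE hn 3 := Fin.ext h1
      obtain rfl : k = Fin.castLE hn 4 := Fin.ext h2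
      have hS : S ⊆ {Fin.castLE hn 0} := by
        intro v hv
        have hvj : (v : ℕ) ≠ 3 := fun h =>
          hj (by rwa [show Fin.castLE hn 3 = v from Fin.ext h.symm])
        have hvk : (v : ℕ) ≠ 4 := fun h =>
          hk (by rwa [show Fin.castLE hn 4 = v from Fin.ext h.symm])
        have := hnS v hv
        exact Finset.mem_singleton.2 (Fin.ext (show (v : ℕ) = 0 by omega))
      rcases Finset.subset_singleton_iff.1 hS with rfl | rfl <;> simp [rules₁]
  · have hlow : ∀ u v : Fin n, (v : ℕ) < 5 → (graph₁ n).Adj u v → (u : ℕ) < 5 := by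
      intro u v hv h
      rw [graph₁_adj] at h
      omega
    have key := fun j k S A => mem_dsep_castLE hn (G := graph₁ n) (g := graph₁ 5)
      (fun _ _ => Iff.rfl) hlow (j := j) (k := k) (S := S) (A := A)
    rintro r (rfl | rfl | rfl | rfl)
    · simpa using key 0 3 ∅ {0, 3}
        (by refine ⟨?_, ?_, ?_, ?_, ?_, ?_, ?_, ?_⟩ <;> decide)
    · simpa using key 0 3 {4} {0, 3, 4}
        (by refine ⟨?_, ?_, ?_, ?_, ?_, ?_, ?_, ?_⟩ <;> decide)
    · simpa using key 3 4 ∅ {0, 3, 4}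
        (by refine ⟨?_, ?_, ?_, ?_, ?_, ?_, ?_, ?_⟩ <;> decide)
    · simpa using key 3 4 {0} {0, 3, 4}
        (by refine ⟨?_, ?_, ?_, ?_, ?_, ?_, ?_, ?_⟩ <;> decide)

theorem graph₂_dsep {n : ℕ} (hn : 5 ≤ n) : (graph₂ n).dsep = rules₂ (Fin.castLE hn) := by
  apply Set.Subset.antisymm
  · refine dsep_subset_of_lt fun j k S hjk he => ?_
    obtain ⟨hne, hj, hk, hs⟩ := mem_dsep.1 he
    have hna := not_adj_of_mem_dsep he
    have hnS : ∀ v ∈ S, ¬ ((graph₂ n).Adj j v ∧ (graph₂ n).Adj k v) := fun v hv h =>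
      hs.not_mem_an hj h.1 h.2 (Or.inl hv)
    have hval : ∀ v ∈ S, (v : ℕ) ≠ j ∧ (v : ℕ) ≠ k := fun v hv =>
      ⟨fun h => hj (Fin.ext h ▸ hv), fun h => hk (Fin.ext h ▸ hv)⟩
    have hk5 : (k : ℕ) < 5 := not_le.1 fun h => hna.1 (graph₂_adj.2 (Or.inr (Or.inl ⟨h, hjk⟩)))
    have hcase : ∀ a b : Fin 5, a < b → ¬ (graph₂ 5).Adj a b ∧ ¬ (graph₂ 5).Adj b a →
      (a : ℕ) = 0 ∧ (b : ℕ) = 3 ∨ (a : ℕ) = 0 ∧ (b : ℕ) = 4 ∨ (a : ℕ) = 1 ∧ (b : ℕ) = 2 := by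
      decide
    replace hcase : (j : ℕ) = 0 ∧ (k : ℕ) = 3 ∨ (j : ℕ) = 0 ∧ (k : ℕ) = 4 ∨
        (j : ℕ) = 1 ∧ (k : ℕ) = 2 :=
      hcase ⟨j, Nat.lt_trans hjk hk5⟩ ⟨k, hk5⟩ hjk hna
    simp only [graph₂_adj] at hnS
    have hadj : ∀ u v : Fin 5, (graph₂ 5).Adj u v →
        (graph₂ n).Adj (Fin.castLE hn u) (Fin.castLE hn v) := fun _ _ h => h
    rcases hcase with ⟨h1, h2⟩ | ⟨h1, h2⟩ | ⟨h1, h2⟩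
    · obtain rfl : j = Fin.castLE hn 0 := Fin.ext h1
      obtain rfl : k = Fin.castLE hn 3 := Fin.ext h2
      obtain rfl : S = ∅ := by
        refine Finset.eq_empty_of_forall_notMem fun v hv => ?_
        have hv4 : (v : ℕ) ≠ 4 := by
          intro h
          refine hs.not_mem_an hj (hadj 0 1 (by simp [graph₂_adj]))
            (hadj 3 1 (by simp [graph₂_adj])) (Or.inr ⟨v, hv, .single ?_⟩)
          rw [show v = Fin.castLE hn 4 from Fin.ext h]
          exact hadj 1 4 (by simp [graph₂_adj])
        have := hnS v hv
        have := hval v hv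
        omega
      simp [rules₂]
    · obtain rfl : j = Fin.castLE hn 0 := Fin.ext h1
      obtain rfl : k = Fin.castLE hn 4 := Fin.ext h2
      have m1 : Fin.castLE hn 1 ∈ S := by
        by_contra h
        exact hs ((Reach.start.child hj (hadj 0 1 (by simp [graph₂_adj]))).child h
          (hadj 1 4 (by simp [graph₂_adj]))).dConnected
      have m2 : Fin.castLE hn 2 ∈ S := by
        by_contra h
        exact hs ((Reach.start.child hj (hadj 0 2 (by simp [graph₂_adj]))).child h
          (hadj 2 4 (by simp [graph₂_adj]))).dConnected
      have m3 : Fin.castLE hn 3 ∈ S := by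
        by_contra h
        exact hs (((Reach.start.child hj (hadj 0 1 (by simp [graph₂_adj]))).coparent (Or.inl m1)
          (hadj 3 1 (by simp [graph₂_adj]))).child h (hadj 3 4 (by simp [graph₂_adj]))).dConnected
      obtain rfl : S = {Fin.castLE hn 1, Fin.castLE hn 2, Fin.castLE hn 3} := by
        refine Finset.Subset.antisymm (fun v hv => ?_)
          (by simp [Finset.insert_subset_iff, m1, m2, m3])
        have := hnS v hv
        have := hval v hv
        simp only [Finset.mem_insert, Finset.mem_singleton, Fin.ext_iff, Fin.val_castLE] at this ⊢
        change (v : ℕ) = 1 ∨ (v : ℕ) = 2 ∨ (v : ℕ) = 3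
        omega
      simp [rules₂]
    · obtain rfl : j = Fin.castLE hn 1 := Fin.ext h1
      obtain rfl : k = Fin.castLE hn 2 := Fin.ext h2
      have m0 : Fin.castLE hn 0 ∈ S := by
        by_contra h
        exact hs ((Reach.start.parent hj (hadj 0 1 (by simp [graph₂_adj]))).child h
          (hadj 0 2 (by simp [graph₂_adj]))).dConnected
      have m3 : Fin.castLE hn 3 ∈ S := by
        by_contra h
        exact hs ((Reach.start.parent hj (hadj 3 1 (by simp [graph₂_adj]))).child h
          (hadj 3 2 (by simp [graph₂_adj]))).dConnected
      obtain rfl : S = {Fin.castLE hn 0, Fin.castLE hn 3} := by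
        refine Finset.Subset.antisymm (fun v hv => ?_) (by simp [Finset.insert_subset_iff, m0, m3])
        have := hnS v hv
        have := hval v hv
        simp only [Finset.mem_insert, Finset.mem_singleton, Fin.ext_iff, Fin.val_castLE] at this ⊢
        change (v : ℕ) = 0 ∨ (v : ℕ) = 3
        omega
      simp [rules₂]
  · have hlow : ∀ u v : Fin n, (v : ℕ) < 5 → (graph₂ n).Adj u v → (u : ℕ) < 5 := by
      intro u v hv h
      rw [graph₂_adj] at h
      omega
    have key := fun j k S A => mem_dsep_castLE hn (G := graph₂ n) (g := graph₂ 5)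
      (fun _ _ => Iff.rfl) hlow (j := j) (k := k) (S := S) (A := A)
    rintro r (rfl | rfl | rfl)
    · simpa using key 0 3 ∅ {0, 3}
        (by refine ⟨?_, ?_, ?_, ?_, ?_, ?_, ?_, ?_⟩ <;> decide)
    · simpa [Finset.map_insert] using key 0 4 {1, 2, 3} {0, 1, 2, 3, 4}
        (by refine ⟨?_, ?_, ?_, ?_, ?_, ?_, ?_, ?_⟩ <;> decide)
    · simpa [Finset.map_insert] using key 1 2 {0, 3} {0, 1, 2, 3}
        (by refine ⟨?_, ?_, ?_, ?_, ?_, ?_, ?_, ?_⟩ <;> decide)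

end DirGraph

/-! ### Conditional independence and residuals -/

section Residual

variable {Ω γ : Type*} {mΩ : MeasurableSpace Ω} {mγ : MeasurableSpace γ}
  {μ : Measure Ω} [IsProbabilityMeasure μ]

/-- The conditional law of `R + h(Y)` given `Y` when `R` has law `ν` and is independent of `Y`. The
measurability of `h` is an argument so that the Markov property can be an instance: for other `h`
the map of a kernel is the zero kernel. -/
noncomputable def shiftKernel (ν : Measure ℝ) [SFinite ν] {h : γ → ℝ} (_hh : Measurable h) :
    Kernel γ ℝ :=
  (Kernel.id ×ₖ Kernel.const γ ν).map fun p => p.2 + h p.1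

instance (ν : Measure ℝ) [IsProbabilityMeasure ν] {h : γ → ℝ} (hh : Measurable h) :
    IsMarkovKernel (shiftKernel ν hh) :=
  Kernel.IsMarkovKernel.map _ (by fun_prop)

theorem shiftKernel_apply (ν : Measure ℝ) [SFinite ν] {h : γ → ℝ} (hh : Measurable h) (y : γ) :
    shiftKernel ν hh y = ν.map fun r => r + h y := by
  rw [shiftKernel, Kernel.map_apply _ (by fun_prop), Kernel.prod_apply, Kernel.id_apply,
    Kernel.const_apply, Measure.dirac_prod, Measure.map_map (by fun_prop) (by fun_prop)]
  rfl

/-- Substitution of a conditioned variable: `R` keeps its law given an independent `Y`. -/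
theorem condDistrib_add_of_indepFun {Y : Ω → γ} {R : Ω → ℝ} {h : γ → ℝ} (hY : Measurable Y)
    (hR : Measurable R) (hh : Measurable h) (hind : IndepFun Y R μ) :
    have := Measure.isProbabilityMeasure_map (μ := μ) hR.aemeasurable
    condDistrib (fun ω => R ω + h (Y ω)) Y μ =ᵐ[μ.map Y] shiftKernel (μ.map R) hh := by
  have := Measure.isProbabilityMeasure_map (μ := μ) hR.aemeasurable
  have := Measure.isProbabilityMeasure_map (μ := μ) hY.aemeasurable
  refine condDistrib_ae_eq_of_measure_eq_compProd Y (by fun_prop) ?_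
  have h1 : μ.map (fun ω => (Y ω, R ω + h (Y ω))) =
      ((μ.map Y).prod (μ.map R)).map (fun p => (p.1, p.2 + h p.1)) := by
    rw [← (indepFun_iff_map_prod_eq_prod_map_map hY.aemeasurable hR.aemeasurable).1 hind,
      Measure.map_map (by fun_prop) (by fun_prop)]
    rfl
  rw [h1]
  refine Measure.ext_of_lintegral _ fun f hf => ?_
  rw [lintegral_map hf (by fun_prop), lintegral_prod _ (by fun_prop),
    Measure.lintegral_compProd hf]
  refine lintegral_congr fun y => ?_
  have hfy : Measurable fun r => f (y, r) := hf.comp measurable_prodMk_left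
  rw [shiftKernel_apply, lintegral_map hfy (by fun_prop)]

/-- If `f = R + h(k)` with `R` independent of `(k, g)`, then `f` and `g` are independent given
`k`. -/
theorem condIndepFun_add_of_indepFun [StandardBorelSpace Ω] {k : Ω → γ} {g R : Ω → ℝ} {h : γ → ℝ}
    (hk : Measurable k) (hg : Measurable g) (hR : Measurable R) (hh : Measurable h)
    (hind : IndepFun (fun ω => (k ω, g ω)) R μ) :
    g ⟂ᵢ[k, hk; μ] (fun ω => R ω + h (k ω)) := by
  have := Measure.isProbabilityMeasure_map (μ := μ) hR.aemeasurable
  rw [condIndepFun_iff_condDistrib_prod_ae_eq_prodMkRight (by fun_prop) hg hk]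
  have h1 := condDistrib_add_of_indepFun (h := fun p : γ × ℝ => h p.1) (hk.prodMk hg) hR
    (by fun_prop) hind
  have h2 := condDistrib_add_of_indepFun hk hR hh (hind.comp measurable_fst measurable_id)
  have h3 : μ.map k = (μ.map fun ω => (k ω, g ω)).map Prod.fst := by
    rw [Measure.map_map (by fun_prop) (by fun_prop)]
    rfl
  rw [h3] at h2
  filter_upwards [h1, ae_of_ae_map (by fun_prop) h2] with p hp1 hp2
  rw [hp1, Kernel.prodMkRight_apply, hp2, shiftKernel_apply, shiftKernel_apply]

/-- If `f = R + h(k)` with `R` independent of `k`, and `f`, `g` are independent given `k`, then `R`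
and `g` are uncorrelated: the conditional mean of `R` given `(k, g)` is the one given `k`, which is
constant. -/
theorem covariance_eq_zero_of_condIndepFun [StandardBorelSpace Ω] {k : Ω → γ} {g R : Ω → ℝ}
    {h : γ → ℝ}
    (hk : Measurable k) (hg : Measurable g) (hR : Measurable R) (hh : Measurable h)
    (hind : IndepFun k R μ) (hR2 : MemLp R 2 μ) (hg2 : MemLp g 2 μ)
    (hhi : Integrable (fun ω => h (k ω)) μ) (hci : g ⟂ᵢ[k, hk; μ] (fun ω => R ω + h (k ω))) :
    cov[R, g; μ] = 0 := by
  have hRi : Integrable R μ := hR2.integrable (by norm_num)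
  have hRgi : Integrable (R * g) μ := hR2.integrable_mul hg2
  have hfi : Integrable (fun ω => R ω + h (k ω)) μ := hRi.add hhi
  have hkg : Measurable fun ω => (k ω, g ω) := hk.prodMk hg
  rw [condIndepFun_iff_condDistrib_prod_ae_eq_prodMkRight (by fun_prop) hg hk] at hci
  have e1 := condExp_ae_eq_integral_condDistrib' hkg hfi
  have e2 := condExp_ae_eq_integral_condDistrib' hk hfi
  have hmk : StronglyMeasurable[mγ.comap k] fun ω => h (k ω) :=
    (hh.comp (comap_measurable k)).stronglyMeasurable
  have hmg : StronglyMeasurable[MeasurableSpace.comap (fun ω => (k ω, g ω)) inferInstance] g :=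
    (measurable_snd.comp (comap_measurable fun ω => (k ω, g ω))).stronglyMeasurable
  have hmkg : StronglyMeasurable[MeasurableSpace.comap (fun ω => (k ω, g ω)) inferInstance]
      fun ω => h (k ω) :=
    ((hh.comp measurable_fst).comp (comap_measurable fun ω => (k ω, g ω))).stronglyMeasurable
  have a1 := condExp_add hRi hhi (MeasurableSpace.comap (fun ω => (k ω, g ω)) inferInstance)
  have a2 := condExp_add hRi hhi (mγ.comap k)
  rw [condExp_of_stronglyMeasurable hkg.comap_le hmkg hhi] at a1
  rw [condExp_of_stronglyMeasurable hk.comap_le hmk hhi] at a2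
  have a3 : μ[R | mγ.comap k] =ᵐ[μ] fun _ => μ[R] :=
    condExp_indep_eq hR.comap_le hk.comap_le (comap_measurable R).stronglyMeasurable hind.symm
  have key : μ[R | MeasurableSpace.comap (fun ω => (k ω, g ω)) inferInstance] =ᵐ[μ]
      fun _ => μ[R] := by
    filter_upwards [e1, e2, a1, a2, a3, ae_of_ae_map hkg.aemeasurable hci] with ω b1 b2 b3 b4 b5 b6
    simp only [Pi.add_apply] at b3 b4
    have : (μ[fun ω => R ω + h (k ω) | MeasurableSpace.comap (fun ω => (k ω, g ω)) inferInstance]) ω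
        = (μ[fun ω => R ω + h (k ω) | mγ.comap k]) ω := by
      rw [b1, b2, b6, Kernel.prodMkRight_apply]
    change (μ[fun ω => R ω + h (k ω) |
      MeasurableSpace.comap (fun ω => (k ω, g ω)) inferInstance]) ω = _ at b3
    change (μ[fun ω => R ω + h (k ω) | mγ.comap k]) ω = _ at b4
    linarith
  rw [covariance_eq_sub hR2 hg2, ← integral_condExp hkg.comap_le,
    integral_congr_ae ((condExp_mul_of_stronglyMeasurable_right hmg hRgi hRi).trans
      (key.mul (ae_eq_refl g)))]
  simp only [Pi.mul_apply, integral_const_mul, sub_self]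

end Residual

/-! ### Gaussian vectors with a given Gram matrix -/

section Gram

variable {V E : Type*} [Fintype V] [DecidableEq V] [NormedAddCommGroup E] [InnerProductSpace ℝ E]

/-- `x j` and `x k` are orthogonal after projecting out the vectors `x s`, `s ∈ S`: some
`r ∈ x j + span (x '' S)` is orthogonal to all `x s` and to `x k`. -/
def PartiallyOrthogonal {V : Type*} (x : V → E) (j k : V) (S : Finset V) : Prop :=
  ∃ r : E, r - x j ∈ Submodule.span ℝ (x '' S) ∧ (∀ s ∈ S, inner ℝ r (x s) = 0) ∧
    inner ℝ r (x k) = 0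

theorem exists_sub_mem_span_inner_eq_zero {V : Type*} (x : V → E) (S : Finset V) (a : E) :
    ∃ r : E, r - a ∈ Submodule.span ℝ (x '' S) ∧ ∀ s ∈ S, inner ℝ r (x s) = 0 := by
  have : FiniteDimensional ℝ (Submodule.span ℝ (x '' (S : Set V))) :=
    FiniteDimensional.span_of_finite ℝ (S.finite_toSet.image x)
  refine ⟨a - (Submodule.span ℝ (x '' S)).starProjection a, ?_, fun s hs => ?_⟩
  · rw [sub_sub_cancel_left]
    exact neg_mem (Submodule.starProjection_apply_mem _ _)
  · have hxs : x s ∈ Submodule.span ℝ (x '' S) := Submodule.subset_span ⟨s, hs, rfl⟩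
    exact Submodule.inner_left_of_mem_orthogonal hxs (Submodule.sub_starProjection_mem_orthogonal a)

theorem inner_eq_zero_of_mem_span {V : Type*} {x : V → E} {S : Finset V} {a b : E}
    (ha : ∀ s ∈ S, inner ℝ a (x s) = 0)
    (hb : b ∈ Submodule.span ℝ (x '' S)) : inner ℝ a b = 0 := by
  induction hb using Submodule.span_induction with
  | mem y hy => obtain ⟨s, hs, rfl⟩ := hy; exact ha s hs
  | zero => exact inner_zero_right _
  | add y z _ _ hy hz => rw [inner_add_right, hy, hz, add_zero]
  | smul c y _ hy => rw [inner_smul_right, hy, mul_zero]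

theorem PartiallyOrthogonal.symm {V : Type*} {x : V → E} {j k : V} {S : Finset V}
    (h : PartiallyOrthogonal x j k S) : PartiallyOrthogonal x k j S := by
  obtain ⟨r, h1, h2, h3⟩ := h
  obtain ⟨q, g1, g2⟩ := exists_sub_mem_span_inner_eq_zero x S (x k)
  refine ⟨q, g1, g2, ?_⟩
  have e1 := inner_eq_zero_of_mem_span g2 h1
  have e2 := inner_eq_zero_of_mem_span h2 g1
  rw [inner_sub_right] at e1 e2
  rw [real_inner_comm] at e1
  linarith

/-- The coordinates of a Gaussian vector with covariance matrix `⟪x i, x j⟫` satisfy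
`X_j ⫫ X_k ∣ X_S` exactly when `x j` and `x k` are orthogonal after projecting out `x '' S`. -/
theorem ciStatement_iff_partiallyOrthogonal {P : ProbabilityMeasure (V → ℝ)} {x : V → E}
    (hP : HasGaussianLaw (fun ω : V → ℝ => ω) (P : Measure (V → ℝ)))
    (hcov : ∀ i j, cov[fun ω : V → ℝ => ω i, fun ω => ω j; (P : Measure (V → ℝ))] =
      inner ℝ (x i) (x j)) {j k : V} {S : Finset V} :
    CIStatement P j k S ↔ PartiallyOrthogonal x j k S := by
  have hL2 : ∀ i, MemLp (fun ω : V → ℝ => ω i) 2 (P : Measure (V → ℝ)) := fun i =>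
    (hP.map_fun (ContinuousLinearMap.proj i)).memLp_two
  have main : ∀ r : E, r - x j ∈ Submodule.span ℝ (x '' S) → (∀ s ∈ S, inner ℝ r (x s) = 0) →
      (CIStatement P j k S ↔ inner ℝ r (x k) = 0) := by
    intro r hr hrS
    obtain ⟨u, hu⟩ := (Submodule.mem_span_image_finset_iff_exists_fun ℝ).1 hr
    -- the residual of `X_j`, and the remaining function of `X_S`
    set R : (V → ℝ) → ℝ := fun ω => ω j + ∑ s : S, u s * ω s with hRdef
    set h : (S → ℝ) → ℝ := fun y => -∑ s : S, u s * y s with hhdef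
    have hRm : Measurable R := by fun_prop
    have hhm : Measurable h := by fun_prop
    have hRh : (fun ω : V → ℝ => ω j) = fun ω => R ω + h (S.restrict ω) := by
      funext ω
      simp only [hRdef, hhdef, Finset.restrict]
      ring
    have hSL2 : ∀ s : S, MemLp (fun ω : V → ℝ => u s * ω s) 2 (P : Measure (V → ℝ)) := fun s =>
      (hL2 s).const_mul _
    have hsumL2 : MemLp (fun ω : V → ℝ => ∑ s : S, u s * ω s) 2 (P : Measure (V → ℝ)) :=
      memLp_finsetSum _ fun s _ => hSL2 s
    have hRcov : ∀ i, cov[R, fun ω => ω i; (P : Measure (V → ℝ))] = inner ℝ r (x i) := by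
      intro i
      rw [show R = (fun ω => ω j) + fun ω => ∑ s : S, u s * ω s from rfl,
        covariance_add_left (hL2 j) hsumL2 (hL2 i), covariance_fun_sum_left hSL2 (hL2 i), hcov,
        ← sub_add_cancel r (x j), ← hu, inner_add_left, sum_inner, add_comm]
      simp only [covariance_const_mul_left, hcov, inner_smul_left, conj_trivial]
    have hRL2 : MemLp R 2 (P : Measure (V → ℝ)) :=
      (hL2 j).add hsumL2
    have hRind : ∀ T : Finset V, (∀ i ∈ T, inner ℝ r (x i) = 0) →
        IndepFun T.restrict R (P : Measure (V → ℝ)) := by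
      intro T hT
      let L : (V → ℝ) →L[ℝ] (Unit → ℝ) × (T → ℝ) :=
        (ContinuousLinearMap.pi fun _ => ContinuousLinearMap.proj j +
          ∑ s : S, u s • ContinuousLinearMap.proj s.1).prod
        (ContinuousLinearMap.pi fun i => ContinuousLinearMap.proj i.1)
      have hL := hP.map_fun L
      have hLe : (fun ω => L ω) = fun ω : V → ℝ => ((fun _ : Unit => R ω), fun i : T => ω i) := by
        funext ω
        simp [L, hRdef]
      rw [hLe] at hL
      have := hL.indepFun_of_covariance_eval (X := fun _ : Unit => R)
        (Y := fun (i : T) (ω : V → ℝ) => ω i) fun _ i => by rw [hRcov, hT i i.2]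
      exact (this.comp (measurable_pi_apply ()) measurable_id).symm
    constructor
    · intro hci
      rw [← hRcov]
      have hci' : (fun ω : V → ℝ => ω k) ⟂ᵢ[S.restrict, S.measurable_restrict;
          (P : Measure (V → ℝ))] fun ω => R ω + h (S.restrict ω) := by
        rw [← hRh]
        exact CondIndepFun.symm hci
      refine covariance_eq_zero_of_condIndepFun S.measurable_restrict (measurable_pi_apply k) hRm
        hhm (hRind S hrS) hRL2 (hL2 k) ?_ hci'
      refine Integrable.neg ?_
      refine integrable_finsetSum _ fun s _ => ?_
      exact ((hL2 s).integrable (by norm_num)).const_mul _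
    · intro h0
      have hind : IndepFun (fun ω : V → ℝ => (S.restrict ω, ω k)) R (P : Measure (V → ℝ)) := by
        have h1 := hRind (insert k S) (by simpa [h0] using hrS)
        exact h1.comp (φ := fun y : {i // i ∈ insert k S} → ℝ =>
          ((fun s : S => y ⟨s, Finset.mem_insert_of_mem s.2⟩),
            y ⟨k, Finset.mem_insert_self k S⟩)) (by fun_prop) measurable_id
      have := condIndepFun_add_of_indepFun S.measurable_restrict (measurable_pi_apply k) hRm hhm
        hind
      rw [← hRh] at this
      exact CondIndepFun.symm this
  constructor
  · intro hci
    obtain ⟨r, h1, h2⟩ := exists_sub_mem_span_inner_eq_zero x S (x j)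
    exact ⟨r, h1, h2, (main r h1 h2).1 hci⟩
  · rintro ⟨r, h1, h2, h3⟩
    exact (main r h1 h2).2 h3

end Gram

/-! ### Linear Gaussian laws -/

section GaussianLaw

variable {V : Type*} [Fintype V]

/-- The law of `M ε` for independent centred Gaussian errors `ε k` of variances `σ2 k`. -/
noncomputable def linearGaussianLaw (M : Matrix V V ℝ) (σ2 : V → ℝ≥0) :
    ProbabilityMeasure (V → ℝ) :=
  ⟨(Measure.pi fun k => gaussianReal 0 (σ2 k)).map fun ε => M.mulVec ε,
    Measure.isProbabilityMeasure_map (by fun_prop)⟩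

theorem iIndepFun_eval_gaussianReal (σ2 : V → ℝ≥0) :
    iIndepFun (fun k (ε : V → ℝ) => ε k) (Measure.pi fun k => gaussianReal 0 (σ2 k)) :=
  iIndepFun_pi (X := fun _ => id) fun _ => aemeasurable_id

theorem hasLaw_eval_gaussianReal (σ2 : V → ℝ≥0) (k : V) :
    HasLaw (fun ε : V → ℝ => ε k) (gaussianReal 0 (σ2 k))
      (Measure.pi fun k => gaussianReal 0 (σ2 k)) :=
  (measurePreserving_eval (fun k => gaussianReal 0 (σ2 k)) k).hasLaw

theorem hasGaussianLaw_linearGaussianLaw (M : Matrix V V ℝ) (σ2 : V → ℝ≥0) :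
    HasGaussianLaw (fun ω : V → ℝ => ω) (linearGaussianLaw M σ2 : Measure (V → ℝ)) := by
  have h1 : HasGaussianLaw (fun ε : V → ℝ => ε) (Measure.pi fun k => gaussianReal 0 (σ2 k)) :=
    (iIndepFun_eval_gaussianReal σ2).hasGaussianLaw fun k =>
      (hasLaw_eval_gaussianReal σ2 k).hasGaussianLaw
  have h2 := h1.map_fun M.mulVecLin.toContinuousLinearMap
  have h3 : IsGaussian (linearGaussianLaw M σ2 : Measure (V → ℝ)) := h2.isGaussian_map
  exact IsGaussian.hasGaussianLaw_id

theorem covariance_linearGaussianLaw [DecidableEq V] (M : Matrix V V ℝ) (σ2 : V → ℝ≥0) (i j : V) :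
    cov[fun ω : V → ℝ => ω i, fun ω => ω j; (linearGaussianLaw M σ2 : Measure (V → ℝ))] =
      ∑ k, M i k * M j k * σ2 k := by
  have hL2 : ∀ k, MemLp (fun ε : V → ℝ => ε k) 2 (Measure.pi fun k => gaussianReal 0 (σ2 k)) :=
    fun k => (hasLaw_eval_gaussianReal σ2 k).hasGaussianLaw.memLp_two
  have hcov : ∀ k l, cov[fun ε : V → ℝ => ε k, fun ε => ε l;
      Measure.pi fun k => gaussianReal 0 (σ2 k)] = if k = l then (σ2 k : ℝ) else 0 := by
    intro k l
    split_ifs with h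
    · subst h
      rw [covariance_self (measurable_pi_apply k).aemeasurable,
        (hasLaw_eval_gaussianReal σ2 k).variance_eq,
        variance_id_gaussianReal]
    · exact ((iIndepFun_eval_gaussianReal σ2).indepFun h).covariance_eq_zero (hL2 k) (hL2 l)
  change cov[_, _; (Measure.pi fun k => gaussianReal 0 (σ2 k)).map fun ε => M.mulVec ε] = _
  rw [covariance_map_fun (measurable_pi_apply i).aestronglyMeasurable
    (measurable_pi_apply j).aestronglyMeasurable (by fun_prop)]
  simp only [Matrix.mulVec, dotProduct]
  rw [covariance_fun_sum_fun_sum (fun k => (hL2 k).const_mul _) (fun k => (hL2 k).const_mul _)]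
  simp only [covariance_const_mul_left, covariance_const_mul_right, hcov, mul_ite, mul_zero,
    Finset.sum_ite_eq, Finset.mem_univ, if_true]
  exact Finset.sum_congr rfl fun k _ => by ring

/-- Any family of vectors of `ℝ^V`, indexed by `V`, is the Gram family of a Gaussian law. -/
theorem ciStatement_linearGaussianLaw_one [DecidableEq V] (x : V → EuclideanSpace ℝ V) {j k : V}
    {S : Finset V} :
    CIStatement (linearGaussianLaw (Matrix.of fun i l => x i l) 1) j k S ↔
      PartiallyOrthogonal x j k S :=
  ciStatement_iff_partiallyOrthogonal (hasGaussianLaw_linearGaussianLaw _ _) fun i j => by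
    rw [covariance_linearGaussianLaw, PiLp.inner_apply]
    simp [mul_comm]

end GaussianLaw

section Coefficients

variable {V E : Type*} [NormedAddCommGroup E] [InnerProductSpace ℝ E] {x y : V → E} {j k : V}
  {S : Finset V}

theorem partiallyOrthogonal_congr (hj : x j = y j) (hk : x k = y k) (hS : ∀ s ∈ S, x s = y s) :
    PartiallyOrthogonal x j k S ↔ PartiallyOrthogonal y j k S := by
  have h : x '' S = y '' S := Set.image_congr fun s hs => hS s hs
  rw [PartiallyOrthogonal, PartiallyOrthogonal, h, hj, hk]
  refine exists_congr fun r => and_congr_right fun _ => and_congr_left fun _ => ?_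
  exact forall₂_congr fun s hs => by rw [hS s hs]

theorem partiallyOrthogonal_comp_iff {W : Type*} (c : W ↪ V) {j k : W} {S : Finset W} :
    PartiallyOrthogonal (x ∘ c) j k S ↔ PartiallyOrthogonal x (c j) (c k) (S.map c) := by
  have h : x '' (c '' S) = (x ∘ c) '' S := (Set.image_comp x c S).symm
  simp only [PartiallyOrthogonal, Finset.coe_map, h, Finset.forall_mem_map, Function.comp_apply]

/-- The coefficients of the residual solve a linear system given by the Gram matrix. -/
theorem PartiallyOrthogonal.exists_coeff [Fintype V] (h : PartiallyOrthogonal x j k S) :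
    ∃ u : V → ℝ, (∀ i, i ∉ S → u i = 0) ∧
      (∀ i ∈ S, inner ℝ (x j) (x i) + ∑ t, u t * inner ℝ (x t) (x i) = 0) ∧
      inner ℝ (x j) (x k) + ∑ t, u t * inner ℝ (x t) (x k) = 0 := by
  classical
  obtain ⟨r, h1, h2, h3⟩ := h
  obtain ⟨u, hu⟩ := (Submodule.mem_span_image_finset_iff_exists_fun ℝ).1 h1
  have hr : ∀ i, inner ℝ r (x i) =
      inner ℝ (x j) (x i) + ∑ t, (if h : t ∈ S then u ⟨t, h⟩ else 0) * inner ℝ (x t) (x i) := by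
    intro i
    have hS : ∑ t, (if h : t ∈ S then u ⟨t, h⟩ else 0) * inner ℝ (x t) (x i) =
        ∑ t : S, u t * inner ℝ (x t) (x i) := by
      rw [← Finset.sum_subset S.subset_univ fun t _ ht => by rw [dif_neg ht, zero_mul],
        ← Finset.sum_coe_sort S]
      exact Finset.sum_congr rfl fun t _ => by rw [dif_pos t.2]
    rw [hS, ← sub_add_cancel r (x j), ← hu, inner_add_left, sum_inner, add_comm]
    simp only [inner_smul_left, conj_trivial]
  refine ⟨fun t => if h : t ∈ S then u ⟨t, h⟩ else 0, fun i hi => dif_neg hi, fun i hi => ?_, ?_⟩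
  · rw [← hr, h2 i hi]
  · rw [← hr, h3]

end Coefficients

/-! ### Distinguishing the two graphs -/

namespace DirGraph

/-- If only `X_3` and `X_4` are correlated, the Markov condition holds for `graph₂`, in which `3`
and `4` are adjacent, but not for `graph₁`, which separates them. -/
theorem graph₁_not_markovEquiv_graph₂ {n : ℕ} (hn : 5 ≤ n) :
    ¬ MarkovEquiv (graph₁ n) (graph₂ n) := by
  intro hM
  set c := Fin.castLE hn with hc
  have h34 : c 3 ≠ c 4 := by simp [hc, Fin.ext_iff]
  set e := EuclideanSpace.basisFun (Fin n) ℝ with he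
  have hee : ∀ i j, inner ℝ (e i) (e j) = if i = j then (1 : ℝ) else 0 :=
    orthonormal_iff_ite.1 e.orthonormal
  set x : Fin n → EuclideanSpace ℝ (Fin n) := fun i => if i = c 4 then e (c 4) + e (c 3) else e i
    with hx
  have horth : ∀ j k, j ≠ c 3 → j ≠ c 4 → j ≠ k → inner ℝ (x j) (x k) = 0 := by
    intro j k h3 h4 hjk
    simp only [hx, if_neg h4]
    split_ifs <;> simp [inner_add_right, hee, h3, h4, hjk]
  have hpo : ∀ j k S, j ≠ c 3 → j ≠ c 4 → j ≠ k → j ∉ S → PartiallyOrthogonal x j k S :=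
    fun j k S h3 h4 hjk hj => ⟨x j, by simp, fun s hs =>
      horth j s h3 h4 fun h => hj (h ▸ hs), horth j k h3 h4 hjk⟩
  have h₂ : CMC (graph₂ n) (linearGaussianLaw (Matrix.of fun i l => x i l) 1) := by
    intro j k S hjk hj hk hs
    rw [ciStatement_linearGaussianLaw_one]
    by_cases hj' : j ≠ c 3 ∧ j ≠ c 4
    · exact hpo j k S hj'.1 hj'.2 hjk hj
    by_cases hk' : k ≠ c 3 ∧ k ≠ c 4
    · exact (hpo k j S hk'.1 hk'.2 hjk.symm hk).symm
    have hna := not_adj_of_mem_dsep (mem_dsep.2 ⟨hjk, hj, hk, hs⟩)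
    have hadj : (graph₂ n).Adj (c 3) (c 4) := graph₂_adj.2 (by simp [hc])
    have : j = c 3 ∧ k = c 4 ∨ j = c 4 ∧ k = c 3 := by grind
    rcases this with ⟨rfl, rfl⟩ | ⟨rfl, rfl⟩
    · exact absurd hadj hna.1
    · exact absurd hadj hna.2
  have h₁ := (hM _).2 h₂
  have hmem : (s(c 3, c 4), (∅ : Finset (Fin n))) ∈ (graph₁ n).dsep := by
    rw [graph₁_dsep hn]
    simp [rules₁, hc]
  have := h₁ _ _ _ h34 (by simp) (by simp) (mem_dsep.1 hmem).2.2.2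
  rw [ciStatement_linearGaussianLaw_one] at this
  obtain ⟨r, hr1, -, hr2⟩ := this
  simp only [Finset.coe_empty, Set.image_empty, Submodule.span_empty, Submodule.mem_bot,
    sub_eq_zero] at hr1
  rw [hr1] at hr2
  simp only [hx, if_neg h34, if_true, inner_add_right, hee] at hr2
  norm_num at hr2

end DirGraph

/-! ### The Gram vectors of the first five vertices -/

section Core

variable {E : Type*} [NormedAddCommGroup E] [InnerProductSpace ℝ E]

/-- The rows of the linear model `X₀ = ε₀`, `X₃ = ε₃`, `X₁ = X₀ + X₃ + ε₁`, `X₂ = X₀ + X₃ + ε₂`,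
`X₄ = X₁ + X₂ - 2 X₃ + ε₄`, in which the effect of `X₃` on `X₄` cancels, expressed in the error
vectors `e`. -/
def coreVec (e : Fin 5 → E) : Fin 5 → E :=
  ![e 0, e 0 + e 3 + e 1, e 0 + e 3 + e 2, e 3, e 0 + e 0 + e 1 + e 2 + e 4]

/-- The Gram matrix of `coreVec`. -/
def coreGram : Fin 5 → Fin 5 → ℝ :=
  ![![1, 1, 1, 0, 2], ![1, 3, 2, 1, 3], ![1, 2, 3, 1, 3], ![0, 1, 1, 1, 0], ![2, 3, 3, 0, 7]]

theorem inner_coreVec {e : Fin 5 → E} (he : Orthonormal ℝ e) (i j : Fin 5) :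
    inner ℝ (coreVec e i) (coreVec e j) = coreGram i j := by
  have hee := orthonormal_iff_ite.1 he
  fin_cases i <;> fin_cases j <;>
    simp [coreVec, coreGram, inner_add_left, inner_add_right, hee,
      -inner_self_eq_norm_sq_to_K] <;> norm_num

theorem linearIndependent_coreVec {e : Fin 5 → E} (he : Orthonormal ℝ e) :
    LinearIndependent ℝ (coreVec e) := by
  have hee := orthonormal_iff_ite.1 he
  rw [Fintype.linearIndependent_iff]
  intro g hg
  have key : ∀ i, ∑ t, g t * inner ℝ (coreVec e t) (e i) = 0 := by
    intro i
    have := congrArg (fun a => inner ℝ a (e i)) hg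
    simpa [sum_inner, inner_smul_left] using this
  have k0 := key 0
  have k1 := key 1
  have k2 := key 2
  have k3 := key 3
  have k4 := key 4
  simp [Fin.sum_univ_five, coreVec, inner_add_left, hee,
    -inner_self_eq_norm_sq_to_K] at k0 k1 k2 k3 k4
  intro i
  fin_cases i <;> simp <;> linarith

/-- For every other pair `j < k` and every `S` the linear system for the coefficients of the
residual of `x j`, orthogonal to `x k` and to `x s` for `s ∈ S`, is inconsistent. -/
theorem partiallyOrthogonal_coreVec_of_lt {e : Fin 5 → E} (he : Orthonormal ℝ e) {j k : Fin 5}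
    {S : Finset (Fin 5)} (hjk : j < k) (hj : j ∉ S) (hk : k ∉ S)
    (h : PartiallyOrthogonal (coreVec e) j k S) : (s(j, k), S) ∈ rules₁ id ∪ rules₂ id := by
  obtain ⟨u, h1, h2, h3⟩ := h.exists_coeff
  simp only [inner_coreVec he, Fin.sum_univ_five] at h2 h3
  have m : ∀ i, (i ∈ S ∧ coreGram j i + (u 0 * coreGram 0 i + u 1 * coreGram 1 i +
      u 2 * coreGram 2 i + u 3 * coreGram 3 i + u 4 * coreGram 4 i) = 0) ∨ (i ∉ S ∧ u i = 0) := by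
    intro i
    by_cases hi : i ∈ S
    · exact Or.inl ⟨hi, h2 i hi⟩
    · exact Or.inr ⟨hi, h1 i hi⟩
  have m0 := m 0
  have m1 := m 1
  have m2 := m 2
  have m3 := m 3
  have m4 := m 4
  clear m h1 h2 h
  fin_cases j <;> fin_cases k <;> first | exact absurd hjk (by decide) | skip
  all_goals
    simp only [Fin.zero_eta, Fin.mk_one, Fin.reduceFinMk, coreGram, Matrix.cons_val]
      at hj hk h3 m0 m1 m2 m3 m4
    rcases m0 with ⟨a0, m0⟩ | ⟨a0, m0⟩ <;> rcases m1 with ⟨a1, m1⟩ | ⟨a1, m1⟩ <;>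
      rcases m2 with ⟨a2, m2⟩ | ⟨a2, m2⟩ <;> rcases m3 with ⟨a3, m3⟩ | ⟨a3, m3⟩ <;>
      rcases m4 with ⟨a4, m4⟩ | ⟨a4, m4⟩ <;>
      first
      | contradiction
      | (exfalso; linarith)
      | simp [rules₁, rules₂, Finset.ext_iff, Fin.forall_fin_succ, a0, a1, a2, a3, a4]

theorem partiallyOrthogonal_coreVec_of_mem_rules {e : Fin 5 → E} (he : Orthonormal ℝ e)
    {j k : Fin 5} {S : Finset (Fin 5)} (h : (s(j, k), S) ∈ rules₁ id ∪ rules₂ id) :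
    PartiallyOrthogonal (coreVec e) j k S := by
  have key : ∀ {a b : Fin 5} {T : Finset (Fin 5)}, PartiallyOrthogonal (coreVec e) a b T →
      (s(j, k), S) = (s(a, b), T) → PartiallyOrthogonal (coreVec e) j k S := by
    intro a b T hab h
    simp only [Prod.mk.injEq, Sym2.eq_iff] at h
    obtain ⟨⟨rfl, rfl⟩ | ⟨rfl, rfl⟩, rfl⟩ := h
    exacts [hab, hab.symm]
  have self : ∀ {a b : Fin 5} {T : Finset (Fin 5)}, (∀ t ∈ T, coreGram a t = 0) →
      coreGram a b = 0 → PartiallyOrthogonal (coreVec e) a b T := fun {a b T} hT hb =>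
    ⟨coreVec e a, by simp, fun t ht => by rw [inner_coreVec he, hT t ht],
      by rw [inner_coreVec he, hb]⟩
  have hspan : ∀ {T : Finset (Fin 5)} {t : Fin 5}, t ∈ T →
      coreVec e t ∈ Submodule.span ℝ (coreVec e '' T) := fun ht =>
    Submodule.subset_span ⟨_, ht, rfl⟩
  have g : ∀ i j, inner ℝ (coreVec e i) (coreVec e j) = coreGram i j := inner_coreVec he
  simp only [rules₁, rules₂, Set.mem_union, Set.mem_insert_iff, Set.mem_singleton_iff, id] at h
  rcases h with (h | h | h | h) | (h | h | h)
  · exact key (self (by simp) (by simp [coreGram])) h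
  · refine key ⟨coreVec e 0 - (2 / 7 : ℝ) • coreVec e 4, ?_, ?_, ?_⟩ h
    · rw [sub_sub_cancel_left]
      exact neg_mem (Submodule.smul_mem _ _ (hspan (by simp)))
    · simp [inner_sub_left, inner_smul_left, g, coreGram, -inner_self_eq_norm_sq_to_K]
    · simp [inner_sub_left, inner_smul_left, g, coreGram, -inner_self_eq_norm_sq_to_K]
  · exact key (self (by simp) (by simp [coreGram])) h
  · exact key (self (by simp [coreGram]) (by simp [coreGram])) h
  · exact key (self (by simp) (by simp [coreGram])) h
  · refine key (PartiallyOrthogonal.symm ⟨coreVec e 4 -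
      (coreVec e 1 + coreVec e 2 - (2 : ℝ) • coreVec e 3), ?_, ?_, ?_⟩) h
    · rw [sub_sub_cancel_left]
      exact neg_mem (sub_mem (add_mem (hspan (by simp)) (hspan (by simp)))
        (Submodule.smul_mem _ _ (hspan (by simp))))
    · simp [inner_sub_left, inner_add_left, inner_smul_left, g, coreGram,
        -inner_self_eq_norm_sq_to_K]
      norm_num
    · simp [inner_sub_left, inner_add_left, inner_smul_left, g, coreGram,
        -inner_self_eq_norm_sq_to_K]
      norm_num
  · refine key ⟨coreVec e 1 - (coreVec e 0 + coreVec e 3), ?_, ?_, ?_⟩ h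
    · rw [sub_sub_cancel_left]
      exact neg_mem (add_mem (hspan (by simp)) (hspan (by simp)))
    · simp [inner_sub_left, inner_add_left, g, coreGram, -inner_self_eq_norm_sq_to_K]
    · simp [inner_sub_left, inner_add_left, g, coreGram, -inner_self_eq_norm_sq_to_K]
      norm_num

theorem partiallyOrthogonal_coreVec_iff {e : Fin 5 → E} (he : Orthonormal ℝ e) {j k : Fin 5}
    {S : Finset (Fin 5)} (hjk : j ≠ k) (hj : j ∉ S) (hk : k ∉ S) :
    PartiallyOrthogonal (coreVec e) j k S ↔ (s(j, k), S) ∈ rules₁ id ∪ rules₂ id := by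
  refine ⟨fun h => ?_, partiallyOrthogonal_coreVec_of_mem_rules he⟩
  rcases lt_or_gt_of_ne hjk with hlt | hlt
  · exact partiallyOrthogonal_coreVec_of_lt he hlt hj hk h
  · rw [Sym2.eq_swap]
    exact partiallyOrthogonal_coreVec_of_lt he hlt hk hj h.symm

theorem image_rules {V : Type*} [DecidableEq V] (c : Fin 5 ↪ V) :
    (fun r : Sym2 (Fin 5) × Finset (Fin 5) => (r.1.map c, r.2.map c)) ''
      (rules₁ id ∪ rules₂ id) = rules₁ c ∪ rules₂ c := by
  simp [rules₁, rules₂, Set.image_insert_eq]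

variable {V : Type*} [DecidableEq V] {c : Fin 5 ↪ V} {x : V → E} {e : Fin 5 → E}

theorem partiallyOrthogonal_of_mem_rules (he : Orthonormal ℝ e) (hx : x ∘ c = coreVec e) {j k : V}
    {S : Finset V} (h : (s(j, k), S) ∈ rules₁ c ∪ rules₂ c) : PartiallyOrthogonal x j k S := by
  rw [← image_rules] at h
  obtain ⟨⟨p, T⟩, hp, h⟩ := h
  induction p using Sym2.ind with
  | _ a b =>
    simp only [Sym2.map_mk, Prod.mk.injEq, Sym2.eq_iff] at h
    have := partiallyOrthogonal_coreVec_of_mem_rules he hp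
    rw [← hx, partiallyOrthogonal_comp_iff] at this
    obtain ⟨⟨rfl, rfl⟩ | ⟨rfl, rfl⟩, rfl⟩ := h
    exacts [this, this.symm]

theorem mem_rules_of_partiallyOrthogonal (he : Orthonormal ℝ e) (hx : x ∘ c = coreVec e) {j k : V}
    {S : Finset V} (hjk : j ≠ k) (hj : j ∉ S) (hk : k ∉ S) (hjc : j ∈ Set.range c)
    (hkc : k ∈ Set.range c) (hSc : (S : Set V) ⊆ Set.range c) (h : PartiallyOrthogonal x j k S) :
    (s(j, k), S) ∈ rules₁ c ∪ rules₂ c := by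
  obtain ⟨a, rfl⟩ := hjc
  obtain ⟨b, rfl⟩ := hkc
  obtain ⟨T, rfl⟩ : ∃ T : Finset (Fin 5), S = T.map c := by
    obtain ⟨T, -, hT⟩ := Finset.subset_set_image_iff.1 (Set.image_univ ▸ hSc)
    exact ⟨T, by rw [← hT, Finset.map_eq_image]⟩
  rw [← partiallyOrthogonal_comp_iff, hx, partiallyOrthogonal_coreVec_iff he (by simpa using hjk)
    (by simpa using hj) (by simpa using hk)] at h
  rw [← image_rules]
  exact ⟨_, h, by simp⟩

end Core

/-! ### Adding a generic sink -/

section Sink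

open Filter Topology

variable {V E : Type*} [NormedAddCommGroup E] [InnerProductSpace ℝ E] {x : V → E}

/-- The part of `a` orthogonal to the vectors `x s`, `s ∈ S`. -/
noncomputable def residualVec (x : V → E) (S : Finset V) (a : E) : E :=
  (exists_sub_mem_span_inner_eq_zero x S a).choose

theorem residualVec_sub_mem_span (x : V → E) (S : Finset V) (a : E) :
    residualVec x S a - a ∈ Submodule.span ℝ (x '' S) :=
  (exists_sub_mem_span_inner_eq_zero x S a).choose_spec.1

theorem inner_residualVec_of_mem (a : E) {S : Finset V} {s : V} (hs : s ∈ S) :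
    inner ℝ (residualVec x S a) (x s) = 0 :=
  (exists_sub_mem_span_inner_eq_zero x S a).choose_spec.2 s hs

theorem eq_residualVec {r a : E} {S : Finset V} (h1 : r - a ∈ Submodule.span ℝ (x '' S))
    (h2 : ∀ s ∈ S, inner ℝ r (x s) = 0) : r = residualVec x S a := by
  have hd : r - residualVec x S a ∈ Submodule.span ℝ (x '' S) := by
    rw [← sub_sub_sub_cancel_right _ _ a]
    exact sub_mem h1 (residualVec_sub_mem_span x S a)
  have h0 := inner_eq_zero_of_mem_span (a := r - residualVec x S a) (fun s hs => by
    rw [inner_sub_left, h2 s hs, inner_residualVec_of_mem _ hs, sub_zero]) hd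
  exact sub_eq_zero.1 (inner_self_eq_zero.1 h0)

theorem residualVec_congr {y : V → E} {S : Finset V} (h : ∀ s ∈ S, x s = y s) (a : E) :
    residualVec x S a = residualVec y S a := by
  refine eq_residualVec ?_ fun s hs => ?_
  · rw [← Set.image_congr fun s hs => h s hs]
    exact residualVec_sub_mem_span x S a
  · rw [← h s hs, inner_residualVec_of_mem a hs]

/-- A vector orthogonal to `x '' S` has the same inner product with `a` and with its residual. -/
theorem inner_residualVec_right {r : E} {S : Finset V} (hr : ∀ s ∈ S, inner ℝ r (x s) = 0) (a : E) :
    inner ℝ r (residualVec x S a) = inner ℝ r a := by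
  have := inner_eq_zero_of_mem_span hr (residualVec_sub_mem_span x S a)
  rwa [inner_sub_right, sub_eq_zero] at this

theorem inner_residualVec_comm (S : Finset V) (a b : E) :
    inner ℝ (residualVec x S a) b = inner ℝ a (residualVec x S b) := by
  rw [← inner_residualVec_right (x := x) (S := S) (fun s hs => inner_residualVec_of_mem a hs) b,
    real_inner_comm, inner_residualVec_right (fun s hs => inner_residualVec_of_mem b hs) a,
    real_inner_comm]

theorem residualVec_ne_zero {T S : Finset V} (hT : LinearIndepOn ℝ x (T : Set V)) {j : V}
    (hj : j ∈ T) (hS : S ⊆ T) (hjS : j ∉ S) : residualVec x S (x j) ≠ 0 := by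
  intro h
  have := residualVec_sub_mem_span x S (x j)
  rw [h, zero_sub, neg_mem_iff] at this
  have hS' : (S : Set V) ⊆ T := by exact_mod_cast hS
  exact hjS ((hT.mono hS').mem_span_iff.1 this (hT.mono (Set.insert_subset hj hS')))

/-- Some small combination of the `x t`, `t ∈ T`, avoids finitely many proper subspaces: all
coefficients are nonzero, and so are the inner products with all residuals. -/
theorem exists_generic_combination [Finite V] {T : Finset V}
    (hT : LinearIndepOn ℝ x (T : Set V)) :
    ∃ w : V → ℝ, (∀ t, w t ≠ 0) ∧
      (∀ j ∈ T, ∀ S ⊆ T, j ∉ S → inner ℝ (residualVec x S (x j)) (∑ t ∈ T, w t • x t) ≠ 0) ∧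
      ∀ j k S, inner ℝ (residualVec x S (x j)) (x k) ≠ 0 →
        |inner ℝ (residualVec x S (x j)) (∑ t ∈ T, w t • x t) *
          inner ℝ (residualVec x S (x k)) (∑ t ∈ T, w t • x t)| <
        |inner ℝ (residualVec x S (x j)) (x k)| := by
  classical
  let F : (V → ℝ) →ₗ[ℝ] E := ∑ t ∈ T, (LinearMap.proj t).smulRight (x t)
  have hF : ∀ w, F w = ∑ t ∈ T, w t • x t := fun w => by simp [F]
  let I := {p : V × Finset V // p.1 ∈ T ∧ p.2 ⊆ T ∧ p.1 ∉ p.2}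
  let ℓ : V ⊕ I → (V → ℝ) →ₗ[ℝ] ℝ := Sum.elim (fun t => LinearMap.proj t)
    fun p => (innerₛₗ ℝ (residualVec x p.1.2 (x p.1.1))).comp F
  obtain ⟨w, hw⟩ : ∃ w, ∀ i, ℓ i w ≠ 0 := by
    by_contra! hcon
    obtain ⟨i, hi⟩ := Subspace.exists_eq_top_of_iUnion_eq_univ (k := ℝ) (p := fun i => (ℓ i).ker)
      (Set.eq_univ_of_forall fun w => Set.mem_iUnion.2 (hcon w))
    rw [LinearMap.ker_eq_top] at hi
    rcases i with t | ⟨⟨j, S⟩, hj, hS, hjS⟩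
    · simpa [ℓ] using LinearMap.congr_fun hi (Pi.single t 1)
    · have h1 := LinearMap.congr_fun hi (Pi.single j 1)
      have h2 : F (Pi.single j 1) = x j := by
        rw [hF, Finset.sum_eq_single_of_mem j hj fun t _ ht => by simp [ht]]
        simp
      simp only [ℓ, Sum.elim_inr, LinearMap.comp_apply, h2, innerₛₗ_apply_apply,
        LinearMap.zero_apply] at h1
      rw [← inner_residualVec_right (fun s hs => inner_residualVec_of_mem _ hs),
        inner_self_eq_zero] at h1
      exact residualVec_ne_zero hT hj hS hjS h1
  have hev : ∀ᶠ ε : ℝ in 𝓝[>] 0, ∀ p : V × V × Finset V,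
      inner ℝ (residualVec x p.2.2 (x p.1)) (x p.2.1) ≠ 0 →
        |ε * inner ℝ (residualVec x p.2.2 (x p.1)) (F w) *
          (ε * inner ℝ (residualVec x p.2.2 (x p.2.1)) (F w))| <
        |inner ℝ (residualVec x p.2.2 (x p.1)) (x p.2.1)| := by
    refine eventually_all.2 fun p => ?_
    by_cases hp : inner ℝ (residualVec x p.2.2 (x p.1)) (x p.2.1) = 0
    · exact Eventually.of_forall fun _ h => absurd hp h
    · have hc : Tendsto (fun ε : ℝ => |ε * inner ℝ (residualVec x p.2.2 (x p.1)) (F w) *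
          (ε * inner ℝ (residualVec x p.2.2 (x p.2.1)) (F w))|) (𝓝 0) (𝓝 0) :=
        Continuous.tendsto' (by fun_prop) _ _ (by simp)
      filter_upwards [(hc.mono_left nhdsWithin_le_nhds).eventually_lt_const (abs_pos.2 hp)]
        with ε hε _ using hε
  obtain ⟨ε, hε, hε0⟩ := (hev.and self_mem_nhdsWithin).exists
  have hε0' : ε ≠ 0 := ne_of_gt hε0
  have hsum : ∑ t ∈ T, (ε • w) t • x t = ε • F w := by
    rw [← hF, map_smul]
  refine ⟨ε • w, fun t => ?_, fun j hj S hS hjS => ?_, fun j k S hp => ?_⟩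
  · exact mul_ne_zero hε0' (hw (Sum.inl t))
  · rw [hsum, inner_smul_right]
    exact mul_ne_zero hε0' (hw (Sum.inr ⟨(j, S), hj, hS, hjS⟩))
  · simpa only [hsum, inner_smul_right] using hε (j, k, S) hp

/-- If `x v` is a generic combination of the `x t`, `t ∈ T`, plus a unit vector orthogonal to them,
then no two vectors of `insert v T` are partially orthogonal in a way that involves `v`. Given a set
containing `v`, this holds since passing from `S` to `insert v S` changes the partial inner product
`p` of `x j` and `x k` by a nonzero amount, which is less than `|p|` if `p ≠ 0`. -/
theorem not_partiallyOrthogonal_of_generic [DecidableEq V] {T S : Finset V} {v j k : V} {w : V → ℝ}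
    {e : E} (hxv : x v = ∑ t ∈ T, w t • x t + e) (he : ‖e‖ = 1)
    (heT : ∀ t ∈ T, inner ℝ (x t) e = 0)
    (hw : ∀ j ∈ T, ∀ S ⊆ T, j ∉ S →
      inner ℝ (residualVec x S (x j)) (∑ t ∈ T, w t • x t) ≠ 0)
    (hsmall : ∀ j ∈ T, ∀ k ∈ T, ∀ S ⊆ T, inner ℝ (residualVec x S (x j)) (x k) ≠ 0 →
      |inner ℝ (residualVec x S (x j)) (∑ t ∈ T, w t • x t) *
        inner ℝ (residualVec x S (x k)) (∑ t ∈ T, w t • x t)| <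
      |inner ℝ (residualVec x S (x j)) (x k)|)
    (hj : j ∈ T) (hk : k ∈ T) (hS : S ⊆ T) (hjS : j ∉ S) (hkS : k ∉ S) :
    ¬ PartiallyOrthogonal x j v S ∧ ¬ PartiallyOrthogonal x j k (insert v S) := by
  have hespan : ∀ {a : E} {S : Finset V}, S ⊆ T → a ∈ Submodule.span ℝ (x '' S) →
      inner ℝ e a = 0 := fun hS ha =>
    inner_eq_zero_of_mem_span (fun s hs => by rw [real_inner_comm]; exact heT s (hS hs)) ha
  have hre : ∀ i ∈ T, inner ℝ (residualVec x S (x i)) e = 0 := by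
    intro i hi
    have := hespan hS (residualVec_sub_mem_span x S (x i))
    rw [inner_sub_right, real_inner_comm, real_inner_comm (x i), heT i hi, sub_zero] at this
    exact this
  have hrv : ∀ i ∈ T, inner ℝ (residualVec x S (x i)) (x v) =
      inner ℝ (residualVec x S (x i)) (∑ t ∈ T, w t • x t) := fun i hi => by
    rw [hxv, inner_add_right, hre i hi, add_zero]
  constructor
  · rintro ⟨r, h1, h2, h3⟩
    rw [eq_residualVec h1 h2, hrv j hj] at h3
    exact hw j hj S hS hjS h3
  · rintro ⟨r, h1, h2, h3⟩
    rw [Finset.coe_insert, Set.image_insert_eq, Submodule.mem_span_insert] at h1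
    obtain ⟨l, s, hs, hr⟩ := h1
    have h2S : ∀ t ∈ S, inner ℝ r (x t) = 0 := fun t ht => h2 t (Finset.mem_insert_of_mem ht)
    have h2v : inner ℝ r (x v) = 0 := h2 v (Finset.mem_insert_self v S)
    have hexp : ∀ a : E, inner ℝ r a = 0 →
        inner ℝ (residualVec x S (x j)) a + l * inner ℝ (residualVec x S (x v)) a = 0 := by
      intro a ha
      rw [← inner_residualVec_right h2S, sub_eq_iff_eq_add.1 hr, inner_add_left, inner_add_left,
        inner_smul_left, real_inner_comm _ s, inner_eq_zero_of_mem_span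
          (fun t ht => inner_residualVec_of_mem a ht) hs, ← inner_residualVec_comm,
        ← inner_residualVec_comm] at ha
      simp only [conj_trivial] at ha
      linarith
    have hk' := hexp _ h3
    have hv' := hexp _ h2v
    -- the part of `x v` orthogonal to `x '' S` is at least as long as `e`
    have hD : 1 ≤ inner ℝ (residualVec x S (x v)) (x v) := by
      have hq : inner ℝ (residualVec x S (x v)) e = 1 := by
        have := hespan hS (residualVec_sub_mem_span x S (x v))
        have hT0 : inner ℝ e (∑ t ∈ T, w t • x t) = 0 := by
          refine hespan (Finset.Subset.refl T) (Submodule.sum_mem _ fun t ht => ?_)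
          exact Submodule.smul_mem _ _ (Submodule.subset_span ⟨t, ht, rfl⟩)
        rw [inner_sub_right, hxv, inner_add_right, hT0, real_inner_self_eq_norm_sq, he, ← hxv]
          at this
        rw [real_inner_comm]
        linarith
      have hle := real_inner_le_norm (residualVec x S (x v)) e
      rw [hq, he, mul_one] at hle
      rw [← inner_residualVec_right fun s hs => inner_residualVec_of_mem _ hs,
        real_inner_self_eq_norm_sq]
      nlinarith
    rw [inner_residualVec_comm S (x v), real_inner_comm (residualVec x S (x k)) (x v), hrv k hk]
      at hk'
    rw [hrv j hj] at hv'
    set p := inner ℝ (residualVec x S (x j)) (x k) with hp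
    set a := inner ℝ (residualVec x S (x j)) (∑ t ∈ T, w t • x t) with ha
    set b := inner ℝ (residualVec x S (x k)) (∑ t ∈ T, w t • x t) with hb
    set D := inner ℝ (residualVec x S (x v)) (x v) with hDdef
    have ha0 : a ≠ 0 := hw j hj S hS hjS
    have hb0 : b ≠ 0 := hw k hk S hS hkS
    have hpD : p * D = a * b := by linear_combination D * hk' - b * hv'
    have hp0 : p ≠ 0 := by
      intro h
      rw [h, zero_mul] at hpD
      exact mul_ne_zero ha0 hb0 hpD.symm
    have := hsmall j hj k hk S hS hp0
    rw [← hpD, abs_mul, abs_of_pos (by linarith : 0 < D)] at this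
    nlinarith [abs_nonneg p]

end Sink

section Chain

variable {E : Type*} [NormedAddCommGroup E] [InnerProductSpace ℝ E]

theorem inner_coreVec_eq_zero {e : Fin 5 → E} {f : E} (h : ∀ a, inner ℝ (e a) f = 0) (a : Fin 5) :
    inner ℝ (coreVec e a) f = 0 := by
  fin_cases a <;> simp [coreVec, inner_add_left, h]

/-- Generic sinks can be added to the first five vertices one after the other, so that no rule
beyond those of the first five vertices holds. -/
theorem exists_generic_sinks {n : ℕ} (hn : 5 ≤ n) {e : Fin n → E} (he : Orthonormal ℝ e) (m : ℕ)
    (hm : 5 ≤ m) (hmn : m ≤ n) :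
    ∃ (x : Fin n → E) (w : Fin n → Fin n → ℝ),
      x ∘ Fin.castLEEmb hn = coreVec (e ∘ Fin.castLEEmb hn) ∧ (∀ i t, w i t ≠ 0) ∧
      (∀ i : Fin n, 5 ≤ (i : ℕ) → (i : ℕ) < m →
        x i = ∑ t with t < i, w i t • x t + e i) ∧
      LinearIndepOn ℝ x ({t | (t : ℕ) < m} : Finset (Fin n)) ∧
      (∀ t i : Fin n, (t : ℕ) < m → m ≤ (i : ℕ) → inner ℝ (x t) (e i) = 0) ∧
      ∀ (j k : Fin n) (S : Finset (Fin n)), (j : ℕ) < m → (k : ℕ) < m → (∀ s ∈ S, (s : ℕ) < m) →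
        j ≠ k → j ∉ S → k ∉ S → PartiallyOrthogonal x j k S →
          (s(j, k), S) ∈ rules₁ (Fin.castLEEmb hn) ∪ rules₂ (Fin.castLEEmb hn) := by
  have hee := orthonormal_iff_ite.1 he
  have hec : Orthonormal ℝ (e ∘ Fin.castLEEmb hn) := he.comp _ (Fin.castLEEmb hn).injective
  have hrange : ∀ i : Fin n, (i : ℕ) < 5 → i ∈ Set.range (Fin.castLEEmb hn) := fun i hi =>
    ⟨⟨i, hi⟩, rfl⟩
  -- In the induction the vectors beyond `m` are irrelevant; the next one is redefined.
  induction m, hm using Nat.le_induction with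
  | base =>
    set x : Fin n → E := fun i =>
      if h : (i : ℕ) < 5 then coreVec (e ∘ Fin.castLEEmb hn) ⟨i, h⟩ else 0 with hx
    have hxc : x ∘ Fin.castLEEmb hn = coreVec (e ∘ Fin.castLEEmb hn) := by
      funext a
      simp [hx]
    refine ⟨x, fun _ _ => 1, hxc, by simp, fun i h1 h2 => by omega, ?_, fun t i ht hi => ?_,
      fun j k S hj hk hS hjk hjS hkS h => ?_⟩
    · have hr : (({t | (t : ℕ) < 5} : Finset (Fin n)) : Set (Fin n)) =
          Set.range (Fin.castLEEmb hn) := by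
        ext i
        simp only [Finset.coe_filter, Finset.mem_univ, true_and, Set.mem_ofPred_eq]
        refine ⟨hrange i, ?_⟩
        rintro ⟨a, rfl⟩
        exact a.2
      rw [hr, linearIndepOn_range_iff (Fin.castLEEmb hn).injective, hxc]
      exact linearIndependent_coreVec hec
    · obtain ⟨a, rfl⟩ := hrange t ht
      rw [show x (Fin.castLEEmb hn a) = _ from congrFun hxc a]
      refine inner_coreVec_eq_zero (fun b => ?_) a
      refine (hee _ _).trans (if_neg fun h => ?_)
      have := b.2
      rw [← h] at hi
      simp at hi
      omega
    · exact mem_rules_of_partiallyOrthogonal hec hxc hjk hjS hkS (hrange j hj) (hrange k hk)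
        (fun s hs => hrange s (hS s hs)) h
  | succ m hm ih =>
    obtain ⟨x, w, hxc, hw0, hxw, hli, horth, hpo⟩ := ih (by omega)
    set v : Fin n := ⟨m, by omega⟩ with hv
    set T : Finset (Fin n) := {t | (t : ℕ) < m} with hT
    have hmT : ∀ {t}, t ∈ T ↔ (t : ℕ) < m := by simp [hT]
    obtain ⟨u, hu0, hu1, hu2⟩ := exists_generic_combination hli
    set y : Fin n → E := Function.update x v (∑ t ∈ T, u t • x t + e v) with hy
    have hyx : ∀ t : Fin n, (t : ℕ) < m → y t = x t := fun t ht =>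
      Function.update_of_ne (fun h => by rw [h] at ht; exact lt_irrefl _ ht) _ _
    have hysum : ∑ t ∈ T, u t • y t = ∑ t ∈ T, u t • x t :=
      Finset.sum_congr rfl fun t ht => by rw [hyx t (hmT.1 ht)]
    have hyv : y v = ∑ t ∈ T, u t • y t + e v := by
      rw [hysum, hy, Function.update_self]
    have hcase : ∀ t : Fin n, (t : ℕ) < m + 1 → t = v ∨ (t : ℕ) < m := fun t ht => by
      rw [hv, Fin.ext_iff]
      simp only
      omega
    have hTe : ∀ t ∈ T, ∀ i : Fin n, m ≤ (i : ℕ) → inner ℝ (y t) (e i) = 0 := fun t ht i hi => by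
      rw [hyx t (hmT.1 ht), horth t i (hmT.1 ht) hi]
    have hTv : ∀ t ∈ T, inner ℝ (y t) (e v) = 0 := fun t ht => hTe t ht v le_rfl
    have hsumv : ∀ i : Fin n, m ≤ (i : ℕ) → inner ℝ (∑ t ∈ T, u t • y t) (e i) = 0 := fun i hi => by
      rw [sum_inner]
      exact Finset.sum_eq_zero fun t ht => by rw [inner_smul_left, hTe t ht i hi, mul_zero]
    have hres : ∀ S ⊆ T, ∀ j ∈ T, residualVec y S (y j) = residualVec x S (x j) :=
      fun S hS j hj => by
        rw [hyx j (hmT.1 hj)]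
        exact residualVec_congr (fun s hs => hyx s (hmT.1 (hS hs))) _
    refine ⟨y, Function.update w v u, ?_, fun i t => ?_, fun i h5 hi => ?_, ?_,
      fun t i ht hi => ?_, fun j k S hj hk hS hjk hjS hkS h => ?_⟩
    · rw [← hxc]
      funext a
      exact hyx _ (lt_of_lt_of_le a.2 hm)
    · rcases eq_or_ne i v with rfl | hi
      · rw [Function.update_self]
        exact hu0 t
      · rw [Function.update_of_ne hi]
        exact hw0 i t
    · rcases hcase i hi with rfl | hi
      · rw [Function.update_self]
        exact hyv
      · rw [hyx i hi, hxw i h5 hi, Function.update_of_ne fun h => by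
          rw [h] at hi; exact lt_irrefl _ hi]
        refine congrArg (· + e i) (Finset.sum_congr rfl fun t ht => ?_)
        rw [hyx t (lt_trans (Fin.lt_def.1 (Finset.mem_filter.1 ht).2) hi)]
    · have hins : (({t | (t : ℕ) < m + 1} : Finset (Fin n)) : Set (Fin n)) =
          insert v (T : Set (Fin n)) := by
        ext i
        simp [hT, hv, Fin.ext_iff]
        omega
      rw [hins]
      refine LinearIndepOn.insert (hli.congr fun t ht => (hyx t (hmT.1 ht)).symm) fun hmem => ?_
      have := inner_eq_zero_of_mem_span (a := e v)
        (fun s hs => by rw [real_inner_comm, hTv s hs]) hmem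
      rw [hyv, inner_add_right, real_inner_comm, hsumv v le_rfl, hee] at this
      simp at this
    · rcases hcase t ht with rfl | ht
      · rw [hyv, inner_add_left, hsumv i (by omega), hee, if_neg, add_zero]
        intro h
        rw [← h] at hi
        simp [hv] at hi
      · exact hTe t (hmT.2 ht) i (by omega)
    · have hgen : ∀ {j k : Fin n} {S : Finset (Fin n)}, j ∈ T → k ∈ T → S ⊆ T → j ∉ S → k ∉ S →
          ¬ PartiallyOrthogonal y j v S ∧ ¬ PartiallyOrthogonal y j k (insert v S) := by
        intro j k S hj hk hS hjS hkS
        refine not_partiallyOrthogonal_of_generic hyv (he.1 v) hTv ?_ ?_ hj hk hS hjS hkS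
        · intro j hj S hS hjS
          rw [hysum, hres S hS j hj]
          exact hu1 j hj S hS hjS
        · intro j hj k hk S hS
          rw [hysum, hres S hS j hj, hres S hS k hk, hyx k (hmT.1 hk)]
          exact hu2 j k S
      have hST : v ∉ S → S ⊆ T := fun hvS s hs =>
        hmT.2 ((hcase s (hS s hs)).resolve_left fun h => hvS (h ▸ hs))
      rcases hcase j hj with rfl | hj
      · have hkT := hmT.2 ((hcase k hk).resolve_left hjk.symm)
        exact absurd h.symm (hgen hkT hkT (hST hjS) hkS hkS).1
      rcases hcase k hk with rfl | hk
      · exact absurd h (hgen (hmT.2 hj) (hmT.2 hj) (hST hkS) hjS hjS).1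
      by_cases hvS : v ∈ S
      · refine absurd h ?_
        rw [← Finset.insert_erase hvS]
        refine (hgen (hmT.2 hj) (hmT.2 hk) (fun s hs => ?_)
          (fun h => hjS (Finset.mem_of_mem_erase h)) fun h => hkS (Finset.mem_of_mem_erase h)).2
        exact hmT.2 ((hcase s (hS s (Finset.mem_of_mem_erase hs))).resolve_left
          (Finset.ne_of_mem_erase hs))
      · have hSm : ∀ s ∈ S, (s : ℕ) < m := fun s hs => hmT.1 (hST hvS hs)
        exact hpo j k S hj hk hSm hjk hjS hkS ((partiallyOrthogonal_congr (hyx j hj) (hyx k hk)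
          fun s hs => hyx s (hSm s hs)).1 h)

end Chain

/-! ### Closing a two-cycle -/

section TwoCycle

/-- Vectors with orthogonal nonzero residuals `x i - ∑ j, B i j • x j` are the Gram family of the
linear Gaussian model with weights `B`. -/
theorem exists_isLinearGaussian {V : Type*} [Fintype V] [DecidableEq V] {G : DirGraph V}
    {x f : V → EuclideanSpace ℝ V} {B : Matrix V V ℝ} (hB : ∀ j k, B k j ≠ 0 ↔ G.Adj j k)
    (hx : ∀ i, x i - ∑ j, B i j • x j = f i) (hf : ∀ i j, i ≠ j → inner ℝ (f i) (f j) = 0)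
    (hf0 : ∀ i, f i ≠ 0) :
    ∃ P : ProbabilityMeasure (V → ℝ), IsLinearGaussian G P ∧
      ∀ j k S, CIStatement P j k S ↔ PartiallyOrthogonal x j k S := by
  set A : Matrix V V ℝ := Matrix.of fun i l => x i l with hA
  set F : Matrix V V ℝ := Matrix.of fun i l => f i l with hF
  set σ2 : V → ℝ≥0 := fun i => ‖f i‖₊ ^ 2 with hσ
  have hinner : ∀ a b : EuclideanSpace ℝ V, inner ℝ a b = ∑ l, a l * b l := fun a b => by
    rw [PiLp.inner_apply]
    simp [mul_comm]
  have hBA : (1 - B) * A = F := by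
    ext i l
    rw [sub_mul, one_mul, Matrix.sub_apply, Matrix.mul_apply, hF, Matrix.of_apply, ← hx i]
    simp [hA]
  have hFF : F * F.transpose = Matrix.diagonal fun i => (σ2 i : ℝ) := by
    ext i j
    rw [Matrix.mul_apply, Matrix.diagonal_apply]
    simp only [Matrix.transpose_apply, hF, Matrix.of_apply]
    rw [← hinner]
    split_ifs with h
    · subst h
      rw [real_inner_self_eq_norm_sq]
      simp [hσ]
    · exact hf i j h
  have hdet : IsUnit (1 - B).det := by
    rw [isUnit_iff_ne_zero]
    intro h
    have h1 := congrArg Matrix.det hFF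
    rw [Matrix.det_mul, ← hBA, Matrix.det_mul, h, zero_mul, zero_mul, Matrix.det_diagonal] at h1
    exact Finset.prod_ne_zero_iff.2 (fun i _ => by simpa [hσ] using hf0 i) h1.symm
  have hAF : (1 - B)⁻¹ * F = A := by
    rw [← hBA, ← mul_assoc, Matrix.nonsing_inv_mul _ hdet, one_mul]
  refine ⟨linearGaussianLaw (1 - B)⁻¹ σ2,
    ⟨B, σ2, hB, hdet, fun i => by simpa [hσ] using hf0 i, rfl⟩,
    fun j k S => ciStatement_iff_partiallyOrthogonal (hasGaussianLaw_linearGaussianLaw _ _) ?_⟩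
  intro i j
  have h1 : (1 - B)⁻¹ * Matrix.diagonal (fun i => (σ2 i : ℝ)) * (1 - B)⁻¹.transpose =
      A * A.transpose := by
    rw [← hFF, ← hAF, Matrix.transpose_mul]
    simp only [mul_assoc]
  rw [covariance_linearGaussianLaw, hinner]
  have h2 := congrFun (congrFun h1 i) j
  rw [Matrix.mul_apply, Matrix.mul_apply] at h2
  simp only [Matrix.mul_diagonal, Matrix.transpose_apply, hA, Matrix.of_apply] at h2
  rw [← h2]
  exact Finset.sum_congr rfl fun k _ => by ring

/-- The weights of the model `coreVec`. -/
def coreWeight : Matrix (Fin 5) (Fin 5) ℝ :=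
  !![0, 0, 0, 0, 0; 1, 0, 0, 1, 0; 1, 0, 0, 1, 0; 0, 0, 0, 0, 0; 0, 1, 1, -2, 0]

theorem coreVec_sub_sum {E : Type*} [NormedAddCommGroup E] [InnerProductSpace ℝ E]
    (e : Fin 5 → E) (a : Fin 5) :
    coreVec e a - ∑ b, coreWeight a b • coreVec e b = e a := by
  fin_cases a <;> simp [Fin.sum_univ_five, coreVec, coreWeight]
  module

theorem coreWeight_ne_zero_iff (a b : Fin 5) :
    coreWeight a b ≠ 0 ↔ (DirGraph.graph₂ 5).Adj b a := by
  rw [DirGraph.graph₂_adj]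
  fin_cases a <;> fin_cases b <;> simp [coreWeight]

open Filter Topology in
/-- A small weight `b` for the edge closing the two-cycle keeps all other weights nonzero. -/
theorem exists_feedback_weight {ι : Type*} [Finite ι] {c : ℝ} (hc : c ≠ 0) {u v : ι → ℝ}
    (hu : ∀ t, u t ≠ 0) (hv : ∀ t, v t ≠ 0) :
    ∃ b : ℝ, b ≠ 0 ∧ 1 - b * c ≠ 0 ∧ c - b / (1 - b * c) ≠ 0 ∧
      ∀ t, (1 - b * c) * u t - b * v t ≠ 0 ∧ v t + b / (1 - b * c) * u t ≠ 0 := by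
  have h : ∀ {f : ℝ → ℝ}, ContinuousAt f 0 → f 0 ≠ 0 → ∀ᶠ b in 𝓝[≠] 0, f b ≠ 0 := fun hf h0 =>
    (hf.eventually_ne h0).filter_mono nhdsWithin_le_nhds
  have h1 : ContinuousAt (fun b : ℝ => b / (1 - b * c)) 0 :=
    ContinuousAt.div (by fun_prop) (by fun_prop) (by simp)
  refine Eventually.exists (f := 𝓝[≠] (0 : ℝ)) ?_
  refine eventually_mem_nhdsWithin.and ((h (f := fun b => 1 - b * c) (by fun_prop) (by simp)).and
    ((h (f := fun b => c - b / (1 - b * c)) (by fun_prop) (by simpa)).and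
      (eventually_all.2 fun t => ?_)))
  exact (h (f := fun b => (1 - b * c) * u t - b * v t) (by fun_prop) (by simpa using hu t)).and
    (h (f := fun b => v t + b / (1 - b * c) * u t) (by fun_prop) (by simpa using hv t))

end TwoCycle

section Twelve

open DirGraph

/-- The sinks `10` and `11`, given by `X₁₀ = ∑ uₜ Xₜ + ε₁₀` and
`X₁₁ = ∑ vₜ Xₜ + c X₁₀ + ε₁₁`, can equally be generated with an additional edge from `11` to `10`
of small weight `b`: the error vectors of `10` and `11` are then rotated. -/
theorem exists_isLinearGaussian_graph₂_twelve {e x : Fin 12 → EuclideanSpace ℝ (Fin 12)}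
    {w : Fin 12 → Fin 12 → ℝ} (he : Orthonormal ℝ e)
    (hxc : x ∘ Fin.castLEEmb (by norm_num : 5 ≤ 12) =
      coreVec (e ∘ Fin.castLEEmb (by norm_num : 5 ≤ 12)))
    (hw : ∀ i t, w i t ≠ 0)
    (hx : ∀ i : Fin 12, 5 ≤ (i : ℕ) → x i = ∑ t with t < i, w i t • x t + e i) :
    ∃ P : ProbabilityMeasure (Fin 12 → ℝ), IsLinearGaussian (graph₂ 12) P ∧
      ∀ j k S, CIStatement P j k S ↔ PartiallyOrthogonal x j k S := by
  have hee := orthonormal_iff_ite.1 he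
  obtain ⟨b, hb0, hb1, hb2, hb3⟩ := exists_feedback_weight (hw 11 10) (hw 10) (hw 11)
  set c := w 11 10 with hc
  set δ := b / (1 - b * c) with hδ
  have hδb : (1 - b * c) * δ = b := mul_div_cancel₀ b hb1
  have hδ0 : δ ≠ 0 := div_ne_zero hb0 hb1
  -- The weights of `10` and `11` are determined by `b` and the requirement that the residuals be
  -- combinations of `e 10` and `e 11`, orthogonal to each other; all others are unchanged.
  set B : Matrix (Fin 12) (Fin 12) ℝ := fun i j =>
    if i = 10 then
      if (j : ℕ) < 10 then (1 - b * c) * w 10 j - b * w 11 j else if j = 11 then b else 0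
    else if i = 11 then
      if (j : ℕ) < 10 then w 11 j + δ * w 10 j else if j = 10 then c - δ else 0
    else if hi : (i : ℕ) < 5 then
      if hj : (j : ℕ) < 5 then coreWeight ⟨i, hi⟩ ⟨j, hj⟩ else 0
    else if j < i then w i j else 0 with hB
  set f : Fin 12 → EuclideanSpace ℝ (Fin 12) := fun i =>
    if i = 10 then (1 - b * c) • e 10 - b • e 11 else if i = 11 then δ • e 10 + e 11 else e i
    with hf
  -- the contribution of the first ten vertices to a combination
  set Q : (Fin 12 → ℝ) → EuclideanSpace ℝ (Fin 12) := fun u =>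
    ∑ t with t < (10 : Fin 12), u t • x t with hQ
  have hQ2 : ∀ (p q : ℝ) (u v : Fin 12 → ℝ),
      Q (fun t => p * u t + q * v t) = p • Q u + q • Q v := by
    intro p q u v
    simp only [hQ, add_smul, mul_smul, Finset.sum_add_distrib, Finset.smul_sum]
  have hx10 : x 10 = Q (w 10) + e 10 := hx 10 (by decide)
  have hx11 : x 11 = Q (w 11) + c • x 10 + e 11 := by
    rw [hx 11 (by decide), show ({t | t < 11} : Finset (Fin 12)) = insert 10
      ({t | t < 10} : Finset (Fin 12)) by decide, Finset.sum_insert (by decide), add_comm (_ • _)]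
  have hsum : ∀ (u : Fin 12 → ℝ) (s : Fin 12) (r : ℝ), 10 ≤ s →
      ∑ t : Fin 12, (if (t : ℕ) < 10 then u t else if t = s then r else 0) • x t =
        Q u + r • x s := by
    intro u s r hs
    have : ∀ t : Fin 12, (if (t : ℕ) < 10 then u t else if t = s then r else 0) • x t =
        (if t < 10 then u t • x t else 0) + if t = s then r • x t else 0 := by
      intro t
      by_cases h1 : (t : ℕ) < 10
      · have h2 : t < 10 := h1
        have h3 : t ≠ s := (lt_of_lt_of_le h2 hs).ne
        simp [h1, h2, h3]
      · have h2 : ¬ t < 10 := h1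
        simp [h1, h2, ite_smul]
    rw [Finset.sum_congr rfl fun t _ => this t, Finset.sum_add_distrib, ← Finset.sum_filter]
    simp [hQ]
  refine exists_isLinearGaussian (G := graph₂ 12) (x := x) (f := f) (B := B) (fun j k => ?_)
    (fun i => ?_) (fun i j hij => ?_) fun i => ?_
  · rw [graph₂_adj]
    by_cases h10 : k = 10
    · subst h10
      by_cases hj : (j : ℕ) < 10
      · have := (hb3 j).1
        simp [hB, hj, this]
      · simp only [hB, if_true, if_neg hj]
        by_cases hj11 : j = 11
        · subst hj11; simp [hb0]
        · have : (j : ℕ) ≠ 11 := fun h => hj11 (Fin.ext h)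
          simp [hj11, this, hj]
    by_cases h11 : k = 11
    · subst h11
      by_cases hj : (j : ℕ) < 10
      · have := (hb3 j).2
        simp [hB, hj, this]
        omega
      · by_cases hj10 : j = 10
        · subst hj10; simp [hB, hb2]
        · have : ¬ (j : ℕ) < 11 := fun h => hj10 (Fin.ext (by simp; omega))
          simp [hB, hj, hj10, this]
    have h10' : (k : ℕ) ≠ 10 := fun h => h10 (Fin.ext h)
    simp only [hB, if_neg h10, if_neg h11]
    by_cases hk : (k : ℕ) < 5
    · rw [dif_pos hk]
      by_cases hj : (j : ℕ) < 5
      · rw [dif_pos hj, coreWeight_ne_zero_iff, graph₂_adj]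
      · simp only [dif_neg hj, ne_eq, not_true_eq_false, false_iff]
        omega
    · rw [dif_neg hk]
      by_cases hj : j < k
      · have := Fin.lt_def.1 hj
        simp [hj, hw]
        omega
      · have := Fin.lt_def.not.1 hj
        simp [hj]
        omega
  · by_cases h10 : i = 10
    · subst h10
      simp only [hB, hf, if_true]
      rw [hsum _ 11 b (by decide)]
      have := hQ2 (1 - b * c) (-b) (w 10) (w 11)
      simp only [neg_mul, ← sub_eq_add_neg] at this
      rw [this, hx11, hx10]
      module
    by_cases h11 : i = 11
    · subst h11
      have hne : (11 : Fin 12) ≠ 10 := by decide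
      simp only [hB, hf, if_true, if_neg hne]
      rw [hsum _ 10 _ le_rfl]
      have := hQ2 1 δ (w 11) (w 10)
      simp only [one_mul] at this
      rw [this, hx11, hx10]
      module
    simp only [hB, hf, if_neg h10, if_neg h11]
    by_cases hi : (i : ℕ) < 5
    · simp only [dif_pos hi]
      have hxa : ∀ a : Fin 5, x (Fin.castLE (by norm_num) a) = _ := fun a => congrFun hxc a
      have h1 := coreVec_sub_sum (e ∘ Fin.castLEEmb (by norm_num : 5 ≤ 12)) ⟨i, hi⟩
      rw [← hxc] at h1
      refine Eq.trans ?_ h1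
      refine congrArg (x i - ·) (Eq.symm ?_)
      refine Fintype.sum_of_injective (Fin.castLEEmb (by norm_num : 5 ≤ 12))
        (Fin.castLEEmb _).injective _ _ (fun t ht => ?_) fun a => ?_
      · rw [dif_neg fun h => ht ⟨⟨t, h⟩, rfl⟩, zero_smul]
      · simp
    · simp only [dif_neg hi, ite_smul, zero_smul, ← Finset.sum_filter]
      rw [hx i (by omega)]
      simp
  · have h1011 : (10 : Fin 12) ≠ 11 := by decide
    have hmix : inner ℝ (f 10) (f 11) = 0 := by
      simp only [hf, if_true, if_neg h1011.symm, inner_sub_left, inner_add_right, inner_smul_left,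
        inner_smul_right, hee, h1011, h1011.symm, conj_trivial, if_false]
      linear_combination hδb
    have hother : ∀ i j, i ≠ 10 → i ≠ 11 → i ≠ j → inner ℝ (f i) (f j) = 0 := by
      intro i j h10 h11 hij
      simp only [hf, if_neg h10, if_neg h11]
      split_ifs <;>
        simp [inner_sub_right, inner_add_right, inner_smul_right, hee, h10, h11, hij]
    by_cases hi : i ≠ 10 ∧ i ≠ 11
    · exact hother i j hi.1 hi.2 hij
    by_cases hj : j ≠ 10 ∧ j ≠ 11
    · rw [real_inner_comm]
      exact hother j i hj.1 hj.2 hij.symm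
    have : i = 10 ∧ j = 11 ∨ i = 11 ∧ j = 10 := by grind
    rcases this with ⟨rfl, rfl⟩ | ⟨rfl, rfl⟩
    · exact hmix
    · rw [real_inner_comm, hmix]
  · intro h
    have h0 : inner ℝ (f i) (e i) = 0 := by rw [h, inner_zero_left]
    simp only [hf] at h0
    split_ifs at h0 with h10 h11
    · subst h10
      simp only [inner_sub_left, inner_smul_left, hee, conj_trivial] at h0
      exact hb1 (by simpa using h0)
    · subst h11
      simp [inner_add_left, inner_smul_left, hee, -inner_self_eq_norm_sq_to_K] at h0
    · simp [hee, -inner_self_eq_norm_sq_to_K] at h0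

end Twelve

theorem mainTheorem3 :
    (∃ (P : ProbabilityMeasure (Fin 5 → ℝ)) (G₁ G₂ : DirGraph (Fin 5)),
      G₁.IsAcyclic ∧ G₂.IsAcyclic ∧
      ∀ C : Set (DirGraph (Fin 5)), (C = {G | G.IsAcyclic} ∨ C = Set.univ) →
        (IdentifiableSMR C G₂ P ∧ ¬ MDR C G₂ P) ∧ (MDR C G₁ P ∧ ¬ WeakSMR C G₁ P)) ∧
    (∃ (P : ProbabilityMeasure (Fin 12 → ℝ)) (G₁ G₂ : DirGraph (Fin 12)),
      ¬ G₁.IsAcyclic ∧ ¬ G₂.IsAcyclic ∧ IsLinearGaussian G₂ P ∧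
      (IdentifiableSMR Set.univ G₂ P ∧ ¬ MDR Set.univ G₂ P) ∧
      (MDR Set.univ G₁ P ∧ ¬ WeakSMR Set.univ G₁ P)) := by
  constructor
  · have he := (EuclideanSpace.basisFun (Fin 5) ℝ).orthonormal
    refine ⟨linearGaussianLaw (Matrix.of fun i l =>
      coreVec (EuclideanSpace.basisFun (Fin 5) ℝ) i l) 1, DirGraph.graph₁ 5, DirGraph.graph₂ 5,
      DirGraph.graph₁_five_isAcyclic, DirGraph.graph₂_five_isAcyclic, fun C hC => ?_⟩
    refine incomparable_of_rules (c := Fin.castLE le_rfl) (Fin.castLE_injective _)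
      (fun j k S hjk hj hk => ?_) (DirGraph.graph₁_dsep le_rfl) (DirGraph.graph₂_dsep le_rfl)
      (DirGraph.graph₁_not_markovEquiv_graph₂ le_rfl) ?_ ?_
    · rw [ciStatement_linearGaussianLaw_one, partiallyOrthogonal_coreVec_iff he hjk hj hk]
      rfl
    · rcases hC with rfl | rfl
      exacts [DirGraph.graph₁_five_isAcyclic, Set.mem_univ _]
    · rcases hC with rfl | rfl
      exacts [DirGraph.graph₂_five_isAcyclic, Set.mem_univ _]
  · have hn : 5 ≤ 12 := by norm_num
    have he := (EuclideanSpace.basisFun (Fin 12) ℝ).orthonormal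
    have hec := he.comp _ (Fin.castLEEmb hn).injective
    obtain ⟨x, w, hxc, hw, hx, -, -, hpo⟩ := exists_generic_sinks hn he 12 hn le_rfl
    obtain ⟨P, hP, hci⟩ := exists_isLinearGaussian_graph₂_twelve he hxc hw fun i hi => hx i hi i.2
    refine ⟨P, DirGraph.graph₁ 12, DirGraph.graph₂ 12, DirGraph.graph₁_twelve_not_isAcyclic,
      DirGraph.graph₂_twelve_not_isAcyclic, hP, ?_⟩
    refine incomparable_of_rules (c := Fin.castLEEmb hn) (Fin.castLEEmb hn).injective
      (fun j k S hjk hj hk => ?_) (DirGraph.graph₁_dsep hn) (DirGraph.graph₂_dsep hn)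
      (DirGraph.graph₁_not_markovEquiv_graph₂ hn) (Set.mem_univ _) (Set.mem_univ _)
    rw [hci]
    exact ⟨hpo j k S j.2 k.2 (fun s _ => s.2) hjk hj hk, partiallyOrthogonal_of_mem_rules hec hxc⟩
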